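/- Consider an exchange economy with $l\ge 1$ goods and $n\ge 1$ traders. Let $X=\mathbb{R}^l_{>0}$, let $S=\mathbb{R}^{l-1}_{>0}\times\{1\}$ be the set of prices (good $l$ is the numeraire), fix $r\in\mathbb{R}^l$ (the total resources), and let $\Omega=\{\omega=(\omega_1,\dots,\omega_n)\in X^n:\sum_{i=1}^n\omega_i=r\}$. Each trader $i$ has a smooth utility function $u_i:X\to\mathbb{R}$ such that for every $x\in X$: (i) $Du_i(x)\in\mathbb{R}^l_{>0}$; (ii) the Hessian $D^2u_i(x)$ is negative definite on the tangent plane at $x$ to the indifference surface $\{y\in X: u_i(y)=u_i(x)\}$, that is, on $\ker Du_i(x)$; (iii) this indifference surface is closed in $X$. For $p\in S$ and $w>0$, let $f_i(p,w)$ be the maximizer of $u_i$ on $\{y\in X: p\cdot y\le w\}$, where it exists (it is then unique). *Equilibria and index.* Put $z(p,\omega)=\sum_{i=1}^n f_i(p,p\cdot\omega_i)-r$. A pair $(p,\omega)\in S\times\Omega$ is an equilibrium if all the demands $f_i(p,p\cdot\omega_i)$ exist and $z(p,\omega)=0$. It is regular if the Jacobian matrix $J(p,\omega)$ of the first $l-1$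 components of $z$ with respect to $(p_1,\dots,p_{l-1})$ is invertible; its index is then the sign ($1$ or $-1$) of $(-1)^{l-1}\det J(p,\omega)$. *Price-income space.* Let $H(r)=\{(p,w)\in S\times\mathbb{R}^n_{>0}:\sum_{i=1}^n w_i=p\cdot r\}$, with coordinates $(p_1,\dots,p_{l-1},w_1,\dots,w_{n-1})$ and the orientation that these give. Let $B(r)$ be the section manifold, the set of $(p,w)\in H(r)$ such that all $f_i(p,w_i)$ exist and $\sum_{i=1}^n f_i(p,w_i)=r$. For $\omega\in\Omega$ let $A(\omega)=\{(p,w)\in H(r): w_i=p\cdot\omega_i,\ 1\le i\le n-1\}$ be the budget space, oriented by the basis $a_1(\omega),\dots,a_{l-1}(\omega)$ of its direction given by $$a_k(\omega)=(0,\dots,0,1,0,\dots,0,\omega_1^k,\dots,\omega_{n-1}^k),\qquad\text{with the entry }1\text{ in position }k,$$ where $\omega_i^k$ is trader $i$'s endowment of good $k$. *Pareto parametrization.* For $v=(v_1,\dots,v_{n-1})$, let $x(v)\in X^n$ be the allocation that maximizes $u_n(x_n)$ among all $x\in X^n$ with $\sum_{i=1}^n x_i=r$ and $u_i(x_i)=v_i$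 for $1\le i\le n-1$; let $p(v)\in S$ be the price vector that supports $x(v)$, that is, $x_i(v)=f_i(p(v),p(v)\cdot x_i(v))$ for all $i$; and let $M(v)=(p(v),p(v)\cdot x_1(v),\dots,p(v)\cdot x_n(v))$. The vectors $\frac{\partial M}{\partial u_1},\dots,\frac{\partial M}{\partial u_{n-1}}$, the partial derivatives of $M$ in the above coordinates with respect to $v_1,\dots,v_{n-1}$, orient $B(r)$. For an equilibrium $(p,\omega)$ let $u_{-n}(p,\omega)=\big(u_i(f_i(p,p\cdot\omega_i))\big)_{1\le i\le n-1}$ and $$\Delta(p,\omega)=\det\Big(a_1(\omega),\dots,a_{l-1}(\omega),\tfrac{\partial M}{\partial u_1}(u_{-n}(p,\omega)),\dots,\tfrac{\partial M}{\partial u_{n-1}}(u_{-n}(p,\omega))\Big).$$ **Proposition.** Let $(p,\omega)$ be a regular equilibrium. Then the index of $(p,\omega)$ is $1$ if and only if $\Delta(p,\omega)>0$, and it is $-1$ if and only if $\Delta(p,\omega)<0$. Moreover $M(u_{-n}(p,\omega))=(p,p\cdot\omega_1,\dots,p\cdot\omega_n)$, and at this point of $H(r)$ the oriented sets $A(\omega)$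 and $B(r)$ intersect transversally, with tangent spaces that have the bases $(a_k(\omega))_k$ and $\big(\frac{\partial M}{\partial u_i}(u_{-n}(p,\omega))\big)_i$, and their intersection number at this point (the sign of the first basis followed by the second with respect to the orientation of $H(r)$) equals the index of $(p,\omega)$. -/

import Mathlib

/-! An exchange economy with `L + 1` goods (the last one is the numeraire) and `N + 1` traders.
The number of goods is `l = L + 1`, the number of traders is `n = N + 1`. -/

noncomputable section

namespace ExchangeEconomy

/-- The commodity space `X`: the strictly positive orthant. -/
def commoditySpace (L : ℕ) : Set (Fin (L + 1) → ℝ) := {x | ∀ j, 0 < x j}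

/-- The price set `S`: strictly positive prices, the last one equal to `1`. -/
def priceSet (L : ℕ) : Set (Fin (L + 1) → ℝ) := {p | (∀ j, 0 < p j) ∧ p (Fin.last L) = 1}

/-- The endowment space `Ω` with total resources `r`. -/
def endowmentSpace {L N : ℕ} (r : Fin (L + 1) → ℝ) : Set (Fin (N + 1) → Fin (L + 1) → ℝ) :=
  {ω | (∀ i, ω i ∈ commoditySpace L) ∧ ∑ i, ω i = r}

/-- The standing hypotheses on a utility function (only its values on `X` matter):
smoothness, smooth monotonicity, smooth strict quasi-concavity (the tangent plane to the
indifference surface at `x` is the kernel of `D u x`), and closedness in `X` of the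
indifference surfaces. -/
structure IsSmoothUtility {L : ℕ} (u : (Fin (L + 1) → ℝ) → ℝ) : Prop where
  smooth : ContDiffOn ℝ ((⊤ : ℕ∞) : WithTop ℕ∞) u (commoditySpace L)
  monotone : ∀ x ∈ commoditySpace L, ∀ j, 0 < fderiv ℝ u x (Pi.single j 1)
  quasiconcave : ∀ x ∈ commoditySpace L, ∀ v, v ≠ 0 → fderiv ℝ u x v = 0 →
    fderiv ℝ (fderiv ℝ u) x v v < 0
  closed : ∀ x ∈ commoditySpace L, IsClosed {y : commoditySpace L | u y = u x}

/-- `x` maximizes the utility `u` over the commodity space under the budget constraint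
`p · y ≤ w`. -/
def IsDemand {L : ℕ} (u : (Fin (L + 1) → ℝ) → ℝ) (p : Fin (L + 1) → ℝ) (w : ℝ)
    (x : Fin (L + 1) → ℝ) : Prop :=
  x ∈ commoditySpace L ∧ p ⬝ᵥ x ≤ w ∧ ∀ y ∈ commoditySpace L, p ⬝ᵥ y ≤ w → u y ≤ u x

/-- The demand `f(p, w)`: the solution of the utility maximization problem. Its value is
used only where a solution exists (it is then unique, by strict quasi-concavity). -/
def demand {L : ℕ} (u : (Fin (L + 1) → ℝ) → ℝ) (p : Fin (L + 1) → ℝ) (w : ℝ) :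
    Fin (L + 1) → ℝ :=
  Classical.epsilon (IsDemand u p w)

/-- The excess demand `z(p, ω)`. -/
def excessDemand {L N : ℕ} (u : Fin (N + 1) → (Fin (L + 1) → ℝ) → ℝ) (r : Fin (L + 1) → ℝ)
    (p : Fin (L + 1) → ℝ) (ω : Fin (N + 1) → Fin (L + 1) → ℝ) : Fin (L + 1) → ℝ :=
  ∑ i, demand (u i) p (p ⬝ᵥ ω i) - r

/-- `(p, ω) ∈ S × Ω` is an equilibrium: every trader has a demand, and the excess demand
vanishes. -/
def IsEquilibrium {L N : ℕ} (u : Fin (N + 1) → (Fin (L + 1) → ℝ) → ℝ) (r : Fin (L + 1) → ℝ)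
    (p : Fin (L + 1) → ℝ) (ω : Fin (N + 1) → Fin (L + 1) → ℝ) : Prop :=
  p ∈ priceSet L ∧ ω ∈ endowmentSpace r ∧ (∀ i, ∃ x, IsDemand (u i) p (p ⬝ᵥ ω i) x) ∧
    excessDemand u r p ω = 0

/-- The Jacobian matrix `J(p, ω)` of the first `l - 1` components of the excess demand with
respect to the first `l - 1` prices. -/
def jacobian {L N : ℕ} (u : Fin (N + 1) → (Fin (L + 1) → ℝ) → ℝ) (r : Fin (L + 1) → ℝ)
    (p : Fin (L + 1) → ℝ) (ω : Fin (N + 1) → Fin (L + 1) → ℝ) : Matrix (Fin L) (Fin L) ℝ :=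
  Matrix.of fun j k =>
    fderiv ℝ (fun q : Fin L → ℝ => (Fin.init (excessDemand u r (Fin.snoc q 1) ω) : Fin L → ℝ))
      (Fin.init p) (Pi.single k 1) j

/-- A regular equilibrium. -/
def IsRegularEquilibrium {L N : ℕ} (u : Fin (N + 1) → (Fin (L + 1) → ℝ) → ℝ)
    (r : Fin (L + 1) → ℝ) (p : Fin (L + 1) → ℝ) (ω : Fin (N + 1) → Fin (L + 1) → ℝ) : Prop :=
  IsEquilibrium u r p ω ∧ IsUnit (jacobian u r p ω)

/-- The index: the sign of `(-1)^(l-1) det J(p, ω)`. -/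
def index {L N : ℕ} (u : Fin (N + 1) → (Fin (L + 1) → ℝ) → ℝ) (r : Fin (L + 1) → ℝ)
    (p : Fin (L + 1) → ℝ) (ω : Fin (N + 1) → Fin (L + 1) → ℝ) : ℤ :=
  (SignType.sign ((-1 : ℝ) ^ L * (jacobian u r p ω).det) : ℤ)

/-- The price-income space `H(r)`. -/
def priceIncomeSpace {L : ℕ} (N : ℕ) (r : Fin (L + 1) → ℝ) :
    Set ((Fin (L + 1) → ℝ) × (Fin (N + 1) → ℝ)) :=
  {b | b.1 ∈ priceSet L ∧ (∀ i, 0 < b.2 i) ∧ ∑ i, b.2 i = b.1 ⬝ᵥ r}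

/-- The coordinates of `H(r)`: the first `l - 1` prices, then the first `n - 1` incomes. -/
def coord {L N : ℕ} (b : (Fin (L + 1) → ℝ) × (Fin (N + 1) → ℝ)) : Fin L ⊕ Fin N → ℝ :=
  Sum.elim (Fin.init b.1 : Fin L → ℝ) (Fin.init b.2 : Fin N → ℝ)

/-- The section manifold `B(r)`. -/
def sectionManifold {L N : ℕ} (u : Fin (N + 1) → (Fin (L + 1) → ℝ) → ℝ)
    (r : Fin (L + 1) → ℝ) : Set ((Fin (L + 1) → ℝ) × (Fin (N + 1) → ℝ)) :=
  {b | b ∈ priceIncomeSpace N r ∧ (∀ i, ∃ x, IsDemand (u i) b.1 (b.2 i) x) ∧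
    ∑ i, demand (u i) b.1 (b.2 i) = r}

/-- The budget space `A(ω)`. -/
def budgetSpace {L N : ℕ} (r : Fin (L + 1) → ℝ) (ω : Fin (N + 1) → Fin (L + 1) → ℝ) :
    Set ((Fin (L + 1) → ℝ) × (Fin (N + 1) → ℝ)) :=
  {b | b ∈ priceIncomeSpace N r ∧ ∀ i : Fin N, b.2 i.castSucc = b.1 ⬝ᵥ ω i.castSucc}

/-- The basis vectors `a_k(ω)` of the direction of `A(ω)`, in coordinates. -/
def budgetVector {L N : ℕ} (ω : Fin (N + 1) → Fin (L + 1) → ℝ) (k : Fin L) :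
    Fin L ⊕ Fin N → ℝ :=
  Sum.elim (Pi.single k 1) (fun i => ω i.castSucc k.castSucc)

/-- `x` is an allocation of `r` in which the first `n - 1` traders have the utility levels
`v`. -/
def IsFeasible {L N : ℕ} (u : Fin (N + 1) → (Fin (L + 1) → ℝ) → ℝ) (r : Fin (L + 1) → ℝ)
    (v : Fin N → ℝ) (x : Fin (N + 1) → Fin (L + 1) → ℝ) : Prop :=
  (∀ i, x i ∈ commoditySpace L) ∧ (∀ i : Fin N, u i.castSucc (x i.castSucc) = v i) ∧
    ∑ i, x i = r

/-- `x` maximizes the utility of the last trader among the allocations of `r` in which the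
other traders have the utility levels `v`. -/
def IsParetoSolution {L N : ℕ} (u : Fin (N + 1) → (Fin (L + 1) → ℝ) → ℝ)
    (r : Fin (L + 1) → ℝ) (v : Fin N → ℝ) (x : Fin (N + 1) → Fin (L + 1) → ℝ) : Prop :=
  IsFeasible u r v x ∧
    ∀ y, IsFeasible u r v y → u (Fin.last N) (y (Fin.last N)) ≤ u (Fin.last N) (x (Fin.last N))

/-- The Pareto optimal allocation `x(v)` with utility levels `v`. -/
def paretoAllocation {L N : ℕ} (u : Fin (N + 1) → (Fin (L + 1) → ℝ) → ℝ)
    (r : Fin (L + 1) → ℝ) (v : Fin N → ℝ) : Fin (N + 1) → Fin (L + 1) → ℝ :=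
  Classical.epsilon (IsParetoSolution u r v)

/-- The price vector `p ∈ S` supports the allocation `x`: each `x i` is optimal for trader `i`
among the goods vectors that cost no more at `p`. -/
def Supports {L N : ℕ} (u : Fin (N + 1) → (Fin (L + 1) → ℝ) → ℝ) (p : Fin (L + 1) → ℝ)
    (x : Fin (N + 1) → Fin (L + 1) → ℝ) : Prop :=
  p ∈ priceSet L ∧ ∀ i, IsDemand (u i) p (p ⬝ᵥ x i) (x i)

/-- The price vector `p(v)` that supports `x(v)`. -/
def paretoPrice {L N : ℕ} (u : Fin (N + 1) → (Fin (L + 1) → ℝ) → ℝ)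
    (r : Fin (L + 1) → ℝ) (v : Fin N → ℝ) : Fin (L + 1) → ℝ :=
  Classical.epsilon fun p => Supports u p (paretoAllocation u r v)

/-- The Pareto parametrization `M` of the section manifold: `M(v) = (p(v), p(v) · x(v))`. -/
def paretoMap {L N : ℕ} (u : Fin (N + 1) → (Fin (L + 1) → ℝ) → ℝ) (r : Fin (L + 1) → ℝ)
    (v : Fin N → ℝ) : (Fin (L + 1) → ℝ) × (Fin (N + 1) → ℝ) :=
  (paretoPrice u r v, fun i => paretoPrice u r v ⬝ᵥ paretoAllocation u r v i)

/-- The partial derivative `∂M/∂u_i` at `v`, in the coordinates of `H(r)`. -/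
def paretoPartial {L N : ℕ} (u : Fin (N + 1) → (Fin (L + 1) → ℝ) → ℝ) (r : Fin (L + 1) → ℝ)
    (v : Fin N → ℝ) (i : Fin N) : Fin L ⊕ Fin N → ℝ :=
  fderiv ℝ (fun v' => coord (paretoMap u r v')) v (Pi.single i 1)

/-- The utility levels `u_i(p, ω) = u_i(f_i(p, p · ω_i))` of the first `n - 1` traders. -/
def utilityLevels {L N : ℕ} (u : Fin (N + 1) → (Fin (L + 1) → ℝ) → ℝ)
    (p : Fin (L + 1) → ℝ) (ω : Fin (N + 1) → Fin (L + 1) → ℝ) (i : Fin N) : ℝ :=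
  u i.castSucc (demand (u i.castSucc) p (p ⬝ᵥ ω i.castSucc))

/-- The determinant of the vectors `a` followed by the vectors `b` (as columns). -/
def frameDet {L N : ℕ} (a : Fin L → Fin L ⊕ Fin N → ℝ) (b : Fin N → Fin L ⊕ Fin N → ℝ) : ℝ :=
  (Matrix.of fun row col => Sum.elim a b col row).det

/-- The determinant `Δ(p, ω)`. -/
def delta {L N : ℕ} (u : Fin (N + 1) → (Fin (L + 1) → ℝ) → ℝ) (r : Fin (L + 1) → ℝ)
    (p : Fin (L + 1) → ℝ) (ω : Fin (N + 1) → Fin (L + 1) → ℝ) : ℝ :=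
  frameDet (budgetVector ω) (paretoPartial u r (utilityLevels u p ω))

/-- The tangent space at `x` of a subset of a Euclidean space (the usual one if the set is a
submanifold). -/
def tangentSpaceAt {ι : Type*} [Fintype ι] (A : Set (ι → ℝ)) (x : ι → ℝ) :
    Submodule ℝ (ι → ℝ) :=
  Submodule.span ℝ (tangentConeAt ℝ A x)

/-- At the common point `x`, the sets `A` and `B`, of complementary dimensions and oriented at
`x` by the bases `a` and `b` of their tangent spaces, intersect transversally with (local)
intersection number `ε`: the sign `ε = ±1` tells whether `a` followed by `b` is a positively or
a negatively oriented basis of the ambient space. -/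
def HasIntersectionNumber {L N : ℕ} (A B : Set (Fin L ⊕ Fin N → ℝ)) (x : Fin L ⊕ Fin N → ℝ)
    (a : Fin L → Fin L ⊕ Fin N → ℝ) (b : Fin N → Fin L ⊕ Fin N → ℝ) (ε : ℤ) : Prop :=
  x ∈ A ∧ x ∈ B ∧
    LinearIndependent ℝ a ∧ Submodule.span ℝ (Set.range a) = tangentSpaceAt A x ∧
    LinearIndependent ℝ b ∧ Submodule.span ℝ (Set.range b) = tangentSpaceAt B x ∧
    IsCompl (tangentSpaceAt A x) (tangentSpaceAt B x) ∧
    ε = (SignType.sign (frameDet a b) : ℤ)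

end ExchangeEconomy

end

/-! Consider the map `equilibriumMap` on the coordinates of the price-income space whose price block
is the excess demand for the non-numeraire goods and whose utility block lists the utility levels of
the first `N` traders. By Walras' law the section manifold lies in the zero set of the price block
and agrees with it near the equilibrium, and `paretoMap` is locally the inverse of this map on `{0}
× ℝ^N`. Hence the derivative `T` sends the Pareto partials to the unit utility vectors, while the
price block of `T (a_k)` is the `k`-th column of the Jacobian `J`. The product of `T` with the frame
is therefore block triangular, and `det T * Δ = det J`.

The sign of `det T` is always `(-1)^L`. Apply `T` to price changes with compensated incomes: by
Roy's identity the utility block vanishes, and the price block is the aggregate substitution matrix,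
which has a negative definite form. On pure income changes the utility block is the diagonal of the
positive marginal utilities. So `(-1)^L det J` and `Δ` have the same sign
(`sign_neg_one_pow_mul_det_eq_sign_frameDet`).

The differentiability of demand comes from the inverse function theorem: demand inverts
`supportingPriceIncome`, whose derivative is injective by the second order condition on utility
(`IsDemand.exists_hasStrictFDerivAt`). -/

open Filter Topology

namespace ExchangeEconomy

/-! ### Second order conditions in one variable. -/

section Segments

theorem eventually_lt_of_hasDerivAt_neg {g : ℝ → ℝ} {g' s : ℝ} (hg : HasDerivAt g g' s)
    (h : g' < 0) : ∀ᶠ t in 𝓝[>] s, g t < g s := by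
  have h1 := (hasDerivAt_iff_tendsto_slope.1 hg).mono_left
    (nhdsWithin_mono s (fun t (ht : s < t) => ht.ne'))
  filter_upwards [h1.eventually_lt_const h, self_mem_nhdsWithin] with t ht hst
  have hst' : 0 < t - s := sub_pos.2 hst
  rw [slope_def_field, div_lt_iff₀ hst'] at ht
  linarith

/-- `g'` is negative just after `s`, so `g` decreases strictly there. The hypothesis on `g` is
one-sided because the lemma is also used at the starting point of a segment. -/
theorem eventually_lt_of_second_derivative_neg {g g' : ℝ → ℝ} {g'' s : ℝ}
    (hg : ∀ᶠ t in 𝓝[≥] s, HasDerivAt g (g' t) t) (hg' : HasDerivAt g' g'' s)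
    (h0 : g' s = 0) (h : g'' < 0) : ∀ᶠ t in 𝓝[>] s, g t < g s := by
  have h1 := eventually_lt_of_hasDerivAt_neg hg' h
  rw [h0] at h1
  obtain ⟨a, ha, hsa⟩ := (mem_nhdsGE_iff_exists_Ico_subset).1 hg
  obtain ⟨b, hb, hsb⟩ := (mem_nhdsGT_iff_exists_Ioo_subset).1 h1
  have hab : s < min a b := lt_min ha hb
  filter_upwards [Ioo_mem_nhdsGT hab] with t ht
  have hta : t < a := ht.2.trans_le (min_le_left _ _)
  have htb : t < b := ht.2.trans_le (min_le_right _ _)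
  have hd : ∀ y ∈ Set.Icc s t, HasDerivAt g (g' y) y := fun y hy =>
    hsa ⟨hy.1, hy.2.trans_lt hta⟩
  have := strictAntiOn_of_deriv_neg (convex_Icc s t)
    (fun y hy => (hd y hy).continuousAt.continuousWithinAt) (fun y hy => by
      rw [interior_Icc] at hy
      rw [(hd y ⟨hy.1.le, hy.2.le⟩).deriv]
      exact hsb ⟨hy.1, hy.2.trans htb⟩)
  exact this ⟨le_rfl, ht.1.le⟩ ⟨ht.1.le, le_rfl⟩ ht.1

/-- If this failed, `g` would have an interior minimum; its derivative vanishes there, and the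
second order condition makes `g` drop below the minimum. -/
theorem min_lt_of_second_derivative_neg {g g' g'' : ℝ → ℝ}
    (hg : ∀ t ∈ Set.Icc (0 : ℝ) 1, HasDerivAt g (g' t) t)
    (hg' : ∀ t ∈ Set.Icc (0 : ℝ) 1, HasDerivAt g' (g'' t) t)
    (h : ∀ t ∈ Set.Icc (0 : ℝ) 1, g' t = 0 → g'' t < 0) {t : ℝ} (ht : t ∈ Set.Ioo (0 : ℝ) 1) :
    min (g 0) (g 1) < g t := by
  by_contra! hle
  obtain ⟨m, hm, hmin⟩ := isCompact_Icc.exists_isMinOn (Set.nonempty_Icc.2 zero_le_one)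
    (fun y hy => (hg y hy).continuousAt.continuousWithinAt)
  have hint : ∃ s ∈ Set.Ioo (0 : ℝ) 1, IsMinOn g (Set.Icc 0 1) s := by
    by_cases hms : m ∈ Set.Ioo (0 : ℝ) 1
    · exact ⟨m, hms, hmin⟩
    -- If the minimum found is at an endpoint, the negated claim makes `t` a minimizer as well.
    · refine ⟨t, ht, fun y hy => (hle.trans ?_).trans (hmin hy)⟩
      have : m = 0 ∨ m = 1 := by
        by_contra! hne
        exact hms ⟨lt_of_le_of_ne hm.1 hne.1.symm, lt_of_le_of_ne hm.2 hne.2⟩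
      rcases this with rfl | rfl
      · exact min_le_left _ _
      · exact min_le_right _ _
  obtain ⟨s, hs, hsmin⟩ := hint
  have hsI : s ∈ Set.Icc (0 : ℝ) 1 := ⟨hs.1.le, hs.2.le⟩
  have hnhds : Set.Icc (0 : ℝ) 1 ∈ 𝓝 s := Icc_mem_nhds hs.1 hs.2
  have h0 : g' s = 0 := (hsmin.isLocalMin hnhds).hasDerivAt_eq_zero (hg s hsI)
  have hev := eventually_lt_of_second_derivative_neg
    (mem_nhdsWithin_of_mem_nhds (mem_of_superset hnhds hg)) (hg' s hsI) h0 (h s hsI h0)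
  obtain ⟨y, hy, hyI⟩ := (hev.and (mem_nhdsWithin_of_mem_nhds hnhds)).exists
  exact absurd (hsmin hyI) (not_le.2 hy)

end Segments

/-! ### The commodity space and normalized prices. -/

theorem isOpen_commoditySpace (L : ℕ) : IsOpen (commoditySpace L) := by
  have : commoditySpace L = ⋂ j, {x | 0 < x j} := by ext; simp [commoditySpace]
  rw [this]
  exact isOpen_iInter_of_finite fun j => isOpen_lt continuous_const (continuous_apply j)

theorem convex_commoditySpace (L : ℕ) : Convex ℝ (commoditySpace L) := by
  intro x hx y hy a b ha hb hab j
  rcases ha.eq_or_lt with rfl | ha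
  · have : b = 1 := by linarith
    simpa [this] using hy j
  · have h1 := mul_pos ha (hx j)
    have h2 := mul_nonneg hb (hy j).le
    simp only [Pi.add_apply, Pi.smul_apply, smul_eq_mul]
    linarith

theorem snoc_dotProduct {L : ℕ} (q : Fin L → ℝ) (a : ℝ) (v : Fin (L + 1) → ℝ) :
    (Fin.snoc q a : Fin (L + 1) → ℝ) ⬝ᵥ v
      = q ⬝ᵥ (Fin.init v : Fin L → ℝ) + a * v (Fin.last L) := by
  simp [dotProduct, Fin.sum_univ_castSucc, Fin.init]

theorem snoc_init_of_last_eq_one {L : ℕ} {p : Fin (L + 1) → ℝ} (hp : p (Fin.last L) = 1) :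
    (Fin.snoc (Fin.init p : Fin L → ℝ) 1 : Fin (L + 1) → ℝ) = p := by
  rw [← hp]
  exact Fin.snoc_init_self p

theorem snoc_mem_priceSet {L : ℕ} {q : Fin L → ℝ} (hq : ∀ j, 0 < q j) :
    (Fin.snoc q 1 : Fin (L + 1) → ℝ) ∈ priceSet L := by
  refine ⟨fun j => ?_, by simp⟩
  refine Fin.lastCases (by simp) (fun i => by simpa using hq i) j

/-! ### Quasi-concavity and first order conditions for demand. -/

section Utility

variable {L : ℕ} {u : (Fin (L + 1) → ℝ) → ℝ}

theorem IsSmoothUtility.contDiffAt (hu : IsSmoothUtility u) {x : Fin (L + 1) → ℝ}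
    (hx : x ∈ commoditySpace L) : ContDiffAt ℝ ((⊤ : ℕ∞) : WithTop ℕ∞) u x :=
  hu.smooth.contDiffAt ((isOpen_commoditySpace L).mem_nhds hx)

theorem IsSmoothUtility.contDiffAt_fderiv (hu : IsSmoothUtility u) {x : Fin (L + 1) → ℝ}
    (hx : x ∈ commoditySpace L) : ContDiffAt ℝ ((⊤ : ℕ∞) : WithTop ℕ∞) (fderiv ℝ u) x :=
  (hu.contDiffAt hx).fderiv_right (by simp)

theorem IsSmoothUtility.hasFDerivAt (hu : IsSmoothUtility u) {x : Fin (L + 1) → ℝ}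
    (hx : x ∈ commoditySpace L) : HasFDerivAt u (fderiv ℝ u x) x :=
  ((hu.contDiffAt hx).differentiableAt (by simp)).hasFDerivAt

theorem IsSmoothUtility.hasFDerivAt_fderiv (hu : IsSmoothUtility u) {x : Fin (L + 1) → ℝ}
    (hx : x ∈ commoditySpace L) : HasFDerivAt (fderiv ℝ u) (fderiv ℝ (fderiv ℝ u) x) x :=
  ((hu.contDiffAt_fderiv hx).differentiableAt (by simp)).hasFDerivAt

theorem hasDerivAt_line (x d : Fin (L + 1) → ℝ) (t : ℝ) :
    HasDerivAt (fun t : ℝ => x + t • d) d t := by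
  simpa using ((hasDerivAt_id t).smul_const d).const_add x

theorem IsSmoothUtility.hasDerivAt_line (hu : IsSmoothUtility u) {x d : Fin (L + 1) → ℝ} {t : ℝ}
    (hx : x + t • d ∈ commoditySpace L) :
    HasDerivAt (fun t : ℝ => u (x + t • d)) (fderiv ℝ u (x + t • d) d) t :=
  (hu.hasFDerivAt hx).comp_hasDerivAt t (ExchangeEconomy.hasDerivAt_line x d t)

theorem IsSmoothUtility.hasDerivAt_line_fderiv (hu : IsSmoothUtility u) {x d : Fin (L + 1) → ℝ}
    {t : ℝ} (hx : x + t • d ∈ commoditySpace L) :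
    HasDerivAt (fun t : ℝ => fderiv ℝ u (x + t • d) d)
      (fderiv ℝ (fderiv ℝ u) (x + t • d) d d) t := by
  have h := (hu.hasFDerivAt_fderiv hx).comp_hasDerivAt t (ExchangeEconomy.hasDerivAt_line x d t)
  exact ((ContinuousLinearMap.apply ℝ ℝ d).hasFDerivAt).comp_hasDerivAt t h

/-- A good that satisfies the first order condition is strictly better than every other good
that costs no more. -/
theorem IsSmoothUtility.lt_of_fderiv_nonpos (hu : IsSmoothUtility u) {x y : Fin (L + 1) → ℝ}
    (hx : x ∈ commoditySpace L) (hy : y ∈ commoditySpace L) (hne : y ≠ x)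
    (h : fderiv ℝ u x (y - x) ≤ 0) : u y < u x := by
  by_contra! hle
  set d := y - x with hd
  have hd0 : d ≠ 0 := sub_ne_zero.2 hne
  have hmem : ∀ t ∈ Set.Icc (0 : ℝ) 1, x + t • d ∈ commoditySpace L := fun t ht =>
    (convex_commoditySpace L).add_smul_sub_mem hx hy ht
  -- If `y` were at least as good as `x`, the open segment between them would be strictly better
  -- than `x`; yet utility decreases at first along it, to first order or, if the slope is zero, to
  -- second order.
  have hq : ∀ t ∈ Set.Ioo (0 : ℝ) 1, u x < u (x + t • d) := by
    intro t ht
    have := min_lt_of_second_derivative_neg (g := fun t : ℝ => u (x + t • d))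
      (fun t ht => hu.hasDerivAt_line (hmem t ht))
      (fun t ht => hu.hasDerivAt_line_fderiv (hmem t ht))
      (fun t ht => hu.quasiconcave _ (hmem t ht) d hd0) ht
    simpa [hd, hle] using this
  have h0 : x + (0 : ℝ) • d ∈ commoditySpace L := by simpa using hx
  have hev : ∀ᶠ t in 𝓝[>] (0 : ℝ), u (x + t • d) < u (x + (0 : ℝ) • d) := by
    rcases h.lt_or_eq with h | h
    · exact eventually_lt_of_hasDerivAt_neg (g := fun t : ℝ => u (x + t • d))
        (hu.hasDerivAt_line h0) (by simpa using h)
    · refine eventually_lt_of_second_derivative_neg (g := fun t : ℝ => u (x + t • d))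
        ?_ (hu.hasDerivAt_line_fderiv h0) (by simpa using h)
        (hu.quasiconcave _ h0 d hd0 (by simpa using h))
      filter_upwards [Icc_mem_nhdsGE (zero_lt_one' ℝ)] with t ht
      exact hu.hasDerivAt_line (hmem t ht)
  obtain ⟨t, ht, htI⟩ := (hev.and (Ioo_mem_nhdsGT (zero_lt_one' ℝ))).exists
  have := hq t htI
  simp only [zero_smul, add_zero] at ht
  linarith

theorem IsSmoothUtility.not_isLocalMax (hu : IsSmoothUtility u) {x : Fin (L + 1) → ℝ}
    (hx : x ∈ commoditySpace L) : ¬ IsLocalMax u x := fun h => by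
  have := hu.monotone x hx 0
  rw [h.fderiv_eq_zero] at this
  simp at this

/-- Demand spends the whole income. -/
theorem IsDemand.dotProduct_eq (hu : IsSmoothUtility u) {p x : Fin (L + 1) → ℝ} {w : ℝ}
    (h : IsDemand u p w x) : p ⬝ᵥ x = w := by
  by_contra hne
  have hlt : p ⬝ᵥ x < w := lt_of_le_of_ne h.2.1 hne
  have hc : Continuous fun y : Fin (L + 1) → ℝ => p ⬝ᵥ y := by
    unfold dotProduct; fun_prop
  refine hu.not_isLocalMax h.1 ?_
  filter_upwards [(isOpen_commoditySpace L).mem_nhds h.1,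
    hc.continuousAt.eventually_lt_const hlt] with y hy hyw
  exact h.2.2 y hy hyw.le

/-- The first order condition for demand. -/
theorem IsDemand.fderiv_eq (hu : IsSmoothUtility u) {p x : Fin (L + 1) → ℝ} {w : ℝ}
    (hp : p ∈ priceSet L) (h : IsDemand u p w x) (d : Fin (L + 1) → ℝ) :
    fderiv ℝ u x d = fderiv ℝ u x (Pi.single (Fin.last L) 1) * (p ⬝ᵥ d) := by
  have key : ∀ v : Fin (L + 1) → ℝ, p ⬝ᵥ v = 0 → fderiv ℝ u x v = 0 := by
    intro v hv
    have h0 : x + (0 : ℝ) • v ∈ commoditySpace L := by simpa using h.1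
    have hmax : IsLocalMax (fun t : ℝ => u (x + t • v)) 0 := by
      have hc : ContinuousAt (fun t : ℝ => x + t • v) 0 := by fun_prop
      filter_upwards [hc.eventually ((isOpen_commoditySpace L).mem_nhds h0)] with t ht
      simp only [zero_smul, add_zero]
      refine h.2.2 _ ht ?_
      simpa [dotProduct_add, dotProduct_smul, hv] using h.2.1
    simpa using hmax.hasDerivAt_eq_zero (hu.hasDerivAt_line h0)
  -- The numeraire has price `1`, so removing `p ⬝ᵥ d` units of it makes the direction cost nothing.
  have := key (d - (p ⬝ᵥ d) • Pi.single (Fin.last L) 1) (by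
    simp [dotProduct_sub, dotProduct_smul, hp.2])
  rw [map_sub, map_smul, smul_eq_mul] at this
  linarith

theorem IsSmoothUtility.isDemand_of_fderiv_eq (hu : IsSmoothUtility u) {p x : Fin (L + 1) → ℝ}
    {c : ℝ} (hc : 0 < c) (hx : x ∈ commoditySpace L)
    (h : ∀ d, fderiv ℝ u x d = c * (p ⬝ᵥ d)) : IsDemand u p (p ⬝ᵥ x) x := by
  refine ⟨hx, le_rfl, fun y hy hyx => ?_⟩
  rcases eq_or_ne y x with rfl | hne
  · exact le_rfl
  · refine (hu.lt_of_fderiv_nonpos hx hy hne ?_).le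
    rw [h, dotProduct_sub]
    nlinarith

theorem IsDemand.lt_of_ne (hu : IsSmoothUtility u) {p x y : Fin (L + 1) → ℝ} {w : ℝ}
    (hp : p ∈ priceSet L) (h : IsDemand u p w x) (hy : y ∈ commoditySpace L)
    (hyw : p ⬝ᵥ y ≤ w) (hne : y ≠ x) : u y < u x := by
  refine hu.lt_of_fderiv_nonpos h.1 hy hne ?_
  rw [h.fderiv_eq hu hp, dotProduct_sub, h.dotProduct_eq hu]
  have := hu.monotone x h.1 (Fin.last L)
  nlinarith

theorem IsDemand.unique (hu : IsSmoothUtility u) {p x y : Fin (L + 1) → ℝ} {w : ℝ}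
    (hp : p ∈ priceSet L) (hx : IsDemand u p w x) (hy : IsDemand u p w y) : y = x := by
  by_contra hne
  exact absurd (hy.2.2 x hx.1 hx.2.1) (not_le.2 (hx.lt_of_ne hu hp hy.1 hy.2.1 hne))

theorem isDemand_demand {p : Fin (L + 1) → ℝ} {w : ℝ} (h : ∃ x, IsDemand u p w x) :
    IsDemand u p w (demand u p w) :=
  Classical.epsilon_spec h

theorem IsDemand.demand_eq (hu : IsSmoothUtility u) {p x : Fin (L + 1) → ℝ} {w : ℝ}
    (hp : p ∈ priceSet L) (h : IsDemand u p w x) : demand u p w = x :=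
  h.unique hu hp (isDemand_demand ⟨x, h⟩)

/-- A good with at least the utility of the demanded one costs at least the income. -/
theorem IsDemand.le_of_le (hu : IsSmoothUtility u) {p x y : Fin (L + 1) → ℝ} {w : ℝ}
    (hp : p ∈ priceSet L) (h : IsDemand u p w x) (hy : y ∈ commoditySpace L)
    (hyx : u x ≤ u y) : w ≤ p ⬝ᵥ y := by
  by_contra! hlt
  rcases eq_or_ne y x with rfl | hne
  · exact hlt.ne (h.dotProduct_eq hu)
  · exact absurd hyx (not_le.2 (h.lt_of_ne hu hp hy hlt.le hne))

/-- The prices that support a good are determined by the good. -/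
theorem IsDemand.price_unique (hu : IsSmoothUtility u) {p q x : Fin (L + 1) → ℝ} {w w' : ℝ}
    (hp : p ∈ priceSet L) (hq : q ∈ priceSet L) (h : IsDemand u p w x)
    (h' : IsDemand u q w' x) : q = p := by
  funext j
  have h1 := h.fderiv_eq hu hp (Pi.single j 1)
  have h2 := h'.fderiv_eq hu hq (Pi.single j 1)
  rw [h1] at h2
  have := mul_left_cancel₀ (hu.monotone x h.1 (Fin.last L)).ne' h2
  simpa using this.symm

end Utility

/-! ### Supporting prices, Roy's identity and differentiability of demand. -/

section Supporting

variable {L : ℕ} {u : (Fin (L + 1) → ℝ) → ℝ}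

/-- The marginal utility of the numeraire. -/
noncomputable def marginalUtility (u : (Fin (L + 1) → ℝ) → ℝ) (x : Fin (L + 1) → ℝ) : ℝ :=
  fderiv ℝ u x (Pi.single (Fin.last L) 1)

/-- The (first `L`) prices and the income for which the good `x` is demanded. -/
noncomputable def supportingPriceIncome (u : (Fin (L + 1) → ℝ) → ℝ) (x : Fin (L + 1) → ℝ) :
    (Fin L → ℝ) × ℝ :=
  (fun j => fderiv ℝ u x (Pi.single j.castSucc 1) / marginalUtility u x,
    fderiv ℝ u x x / marginalUtility u x)

theorem IsSmoothUtility.marginalUtility_pos (hu : IsSmoothUtility u) {x : Fin (L + 1) → ℝ}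
    (hx : x ∈ commoditySpace L) : 0 < marginalUtility u x :=
  hu.monotone x hx _

theorem IsSmoothUtility.contDiffAt_marginalUtility (hu : IsSmoothUtility u)
    {x : Fin (L + 1) → ℝ} (hx : x ∈ commoditySpace L) :
    ContDiffAt ℝ ((⊤ : ℕ∞) : WithTop ℕ∞) (marginalUtility u) x :=
  (hu.contDiffAt_fderiv hx).clm_apply contDiffAt_const

theorem IsSmoothUtility.contDiffAt_supportingPriceIncome (hu : IsSmoothUtility u)
    {x : Fin (L + 1) → ℝ} (hx : x ∈ commoditySpace L) :
    ContDiffAt ℝ ((⊤ : ℕ∞) : WithTop ℕ∞) (supportingPriceIncome u) x := by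
  have hm := hu.contDiffAt_marginalUtility hx
  have hm0 := (hu.marginalUtility_pos hx).ne'
  refine ContDiffAt.prodMk (contDiffAt_pi.2 fun j => ?_) ?_
  · exact ((hu.contDiffAt_fderiv hx).clm_apply contDiffAt_const).div hm hm0
  · exact ((hu.contDiffAt_fderiv hx).clm_apply contDiffAt_id).div hm hm0

theorem IsSmoothUtility.fderiv_eq_supporting (hu : IsSmoothUtility u) {x : Fin (L + 1) → ℝ}
    (hx : x ∈ commoditySpace L) (d : Fin (L + 1) → ℝ) :
    fderiv ℝ u x d = marginalUtility u x *
      ((Fin.snoc (supportingPriceIncome u x).1 1 : Fin (L + 1) → ℝ) ⬝ᵥ d) := by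
  have hm0 := (hu.marginalUtility_pos hx).ne'
  have hd : d = ∑ j, d j • (Pi.single j 1 : Fin (L + 1) → ℝ) := by
    simpa using pi_eq_sum_univ' d
  conv_lhs => rw [hd]
  rw [map_sum, snoc_dotProduct, Fin.sum_univ_castSucc]
  simp only [map_smul, smul_eq_mul, dotProduct, supportingPriceIncome, Fin.init, mul_add,
    Finset.mul_sum, one_mul]
  congr 1
  · refine Finset.sum_congr rfl fun j _ => ?_
    field_simp
  · rw [mul_comm]; rfl

theorem IsSmoothUtility.supporting_fst_pos (hu : IsSmoothUtility u) {x : Fin (L + 1) → ℝ}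
    (hx : x ∈ commoditySpace L) (j : Fin L) : 0 < (supportingPriceIncome u x).1 j :=
  div_pos (hu.monotone x hx _) (hu.marginalUtility_pos hx)

theorem IsSmoothUtility.supporting_dotProduct (hu : IsSmoothUtility u) {x : Fin (L + 1) → ℝ}
    (hx : x ∈ commoditySpace L) :
    (Fin.snoc (supportingPriceIncome u x).1 1 : Fin (L + 1) → ℝ) ⬝ᵥ x
      = (supportingPriceIncome u x).2 := by
  have hm0 := (hu.marginalUtility_pos hx).ne'
  have h := hu.fderiv_eq_supporting hx x
  simp only [supportingPriceIncome] at h ⊢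
  rw [h]
  field_simp

theorem IsSmoothUtility.isDemand_supporting (hu : IsSmoothUtility u) {x : Fin (L + 1) → ℝ}
    (hx : x ∈ commoditySpace L) :
    IsDemand u (Fin.snoc (supportingPriceIncome u x).1 1) (supportingPriceIncome u x).2 x := by
  have := hu.isDemand_of_fderiv_eq (hu.marginalUtility_pos hx) hx (hu.fderiv_eq_supporting hx)
  rwa [hu.supporting_dotProduct hx] at this

theorem IsDemand.supporting_eq (hu : IsSmoothUtility u) {p x : Fin (L + 1) → ℝ} {w : ℝ}
    (hp : p ∈ priceSet L) (h : IsDemand u p w x) :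
    supportingPriceIncome u x = (Fin.init p, w) := by
  have hx := h.1
  have h1 := h.price_unique hu hp (snoc_mem_priceSet (hu.supporting_fst_pos hx))
    (hu.isDemand_supporting hx)
  have h2 := hu.supporting_dotProduct hx
  rw [h1, h.dotProduct_eq hu] at h2
  refine Prod.ext ?_ h2.symm
  rw [← h1, Fin.init_snoc]

/-- The derivative of the identities `Du(x) d = λ(x) (q(x) · d)` and `Du(x) x = λ(x) w(x)`. -/
theorem IsSmoothUtility.exists_fderiv_fderiv_eq (hu : IsSmoothUtility u)
    {x : Fin (L + 1) → ℝ} (hx : x ∈ commoditySpace L) :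
    ∃ m : (Fin (L + 1) → ℝ) →L[ℝ] ℝ, (∀ d v : Fin (L + 1) → ℝ,
      fderiv ℝ (fderiv ℝ u) x d v =
        m d * ((Fin.snoc (supportingPriceIncome u x).1 1 : Fin (L + 1) → ℝ) ⬝ᵥ v) +
        marginalUtility u x *
          ((fderiv ℝ (supportingPriceIncome u) x d).1 ⬝ᵥ (Fin.init v : Fin L → ℝ))) ∧
      ∀ d : Fin (L + 1) → ℝ, fderiv ℝ (fderiv ℝ u) x d x + fderiv ℝ u x d =
        m d * (supportingPriceIncome u x).2 +
        marginalUtility u x * (fderiv ℝ (supportingPriceIncome u) x d).2 := by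
  have hnhds := (isOpen_commoditySpace L).mem_nhds hx
  have hm := ((hu.contDiffAt_marginalUtility hx).differentiableAt (by simp)).hasFDerivAt
  have hs := ((hu.contDiffAt_supportingPriceIncome hx).differentiableAt (by simp)).hasFDerivAt
  have hD := hu.hasFDerivAt_fderiv hx
  refine ⟨fderiv ℝ (marginalUtility u) x, fun d v => ?_, fun d => ?_⟩
  · have h1 : HasDerivAt (fun t : ℝ => fderiv ℝ u (x + t • d) v)
        (fderiv ℝ (fderiv ℝ u) x d v) 0 := by
      have h := HasFDerivAt.comp_hasDerivAt_of_eq 0 hD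
        (ExchangeEconomy.hasDerivAt_line x d 0) (by simp)
      exact ((ContinuousLinearMap.apply ℝ ℝ v).hasFDerivAt).comp_hasDerivAt 0 h
    have h2 := HasFDerivAt.comp_hasDerivAt_of_eq 0 hm
      (ExchangeEconomy.hasDerivAt_line x d 0) (by simp)
    have h3 := HasFDerivAt.comp_hasDerivAt_of_eq 0 hs
      (ExchangeEconomy.hasDerivAt_line x d 0) (by simp)
    have h4 : HasDerivAt (fun t : ℝ => (Fin.snoc (supportingPriceIncome u (x + t • d)).1 1 :
        Fin (L + 1) → ℝ) ⬝ᵥ v) ((fderiv ℝ (supportingPriceIncome u) x d).1 ⬝ᵥ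
          (Fin.init v : Fin L → ℝ)) 0 := by
      have h5 := hasDerivAt_pi.1 (HasFDerivAt.comp_hasDerivAt 0 hasFDerivAt_fst h3)
      simp only [snoc_dotProduct]
      refine HasDerivAt.add_const _ ?_
      simp only [dotProduct]
      exact HasDerivAt.fun_sum fun j _ => (h5 j).mul_const _
    have h6 := h2.mul h4
    refine h1.unique ((h6.congr_of_eventuallyEq ?_).congr_deriv (by simp))
    have hc : ContinuousAt (fun t : ℝ => x + t • d) 0 := by fun_prop
    have h0 : commoditySpace L ∈ 𝓝 (x + (0 : ℝ) • d) := by rwa [zero_smul, add_zero]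
    filter_upwards [hc.eventually h0] with t ht
    exact hu.fderiv_eq_supporting ht v
  · have h1 : HasFDerivAt (fun y => fderiv ℝ u y y) _ x := hD.clm_apply (hasFDerivAt_id x)
    have h2 := hm.mul (hasFDerivAt_snd.comp x hs)
    have h3 := h1.unique (h2.congr_of_eventuallyEq (by
      filter_upwards [hnhds] with y hy
      have h := hu.fderiv_eq_supporting hy y
      rw [hu.supporting_dotProduct hy] at h
      exact h))
    have h4 := congrArg (fun f => f d) h3
    simp at h4
    linarith

/-- Roy's identity. -/
theorem IsSmoothUtility.fderiv_eq_fderiv_supporting (hu : IsSmoothUtility u)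
    {x : Fin (L + 1) → ℝ} (hx : x ∈ commoditySpace L) (d : Fin (L + 1) → ℝ) :
    fderiv ℝ u x d = marginalUtility u x * ((fderiv ℝ (supportingPriceIncome u) x d).2 -
      (fderiv ℝ (supportingPriceIncome u) x d).1 ⬝ᵥ (Fin.init x : Fin L → ℝ)) := by
  obtain ⟨m, h1, h2⟩ := hu.exists_fderiv_fderiv_eq hx
  -- The first identity with `v = x` and the second share the unknown term in `m`; subtraction
  -- removes it.
  have h3 := h2 d
  rw [h1, hu.supporting_dotProduct hx] at h3
  linarith

/-- Negativity of the substitution effect. -/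
theorem IsSmoothUtility.fderiv_supporting_dotProduct_neg (hu : IsSmoothUtility u)
    {x : Fin (L + 1) → ℝ} (hx : x ∈ commoditySpace L) {d : Fin (L + 1) → ℝ} (hd : d ≠ 0)
    (h : (fderiv ℝ (supportingPriceIncome u) x d).2 =
      (fderiv ℝ (supportingPriceIncome u) x d).1 ⬝ᵥ (Fin.init x : Fin L → ℝ)) :
    (fderiv ℝ (supportingPriceIncome u) x d).1 ⬝ᵥ (Fin.init d : Fin L → ℝ) < 0 := by
  obtain ⟨m, h1, h2⟩ := hu.exists_fderiv_fderiv_eq hx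
  -- Compensation keeps utility constant to first order, so `d` costs nothing at the supporting
  -- prices. The term in `m` then drops out of the Hessian, leaving the marginal utility times the
  -- substitution term.
  have h0 : fderiv ℝ u x d = 0 := by rw [hu.fderiv_eq_fderiv_supporting hx, h]; simp
  have hm := hu.marginalUtility_pos hx
  have hp := hu.fderiv_eq_supporting hx d
  rw [h0, zero_eq_mul, or_iff_right hm.ne'] at hp
  have hq := hu.quasiconcave x hx d hd h0
  rw [h1, hp, mul_zero, zero_add] at hq
  exact (mul_neg_iff.1 hq).resolve_right (fun h => absurd hm h.1.not_gt) |>.2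

/-- A nonzero vector in the kernel would be trivially compensated, with a substitution term that is
both zero and negative. -/
theorem IsSmoothUtility.injective_fderiv_supporting (hu : IsSmoothUtility u)
    {x : Fin (L + 1) → ℝ} (hx : x ∈ commoditySpace L) :
    Function.Injective (fderiv ℝ (supportingPriceIncome u) x) := by
  refine (injective_iff_map_eq_zero _).2 fun d hd => ?_
  by_contra hne
  have := hu.fderiv_supporting_dotProduct_neg hx hne (by simp [hd])
  simp [hd] at this

/-- Near prices and an income for which it exists, demand exists and is strictly differentiable;
its derivative satisfies Roy's identity and has a negative substitution effect. -/
theorem IsDemand.exists_hasStrictFDerivAt (hu : IsSmoothUtility u) {p x : Fin (L + 1) → ℝ}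
    {w : ℝ} (hp : p ∈ priceSet L) (h : IsDemand u p w x) :
    ∃ F' : (Fin L → ℝ) × ℝ →L[ℝ] (Fin (L + 1) → ℝ),
      HasStrictFDerivAt (fun z : (Fin L → ℝ) × ℝ => demand u (Fin.snoc z.1 1) z.2) F'
        (Fin.init p, w) ∧
      (∀ᶠ z : (Fin L → ℝ) × ℝ in 𝓝 (Fin.init p, w),
        IsDemand u (Fin.snoc z.1 1) z.2 (demand u (Fin.snoc z.1 1) z.2)) ∧
      (∀ z : (Fin L → ℝ) × ℝ, fderiv ℝ u x (F' z) =
        marginalUtility u x * (z.2 - z.1 ⬝ᵥ (Fin.init x : Fin L → ℝ))) ∧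
      ∀ q : Fin L → ℝ, q ≠ 0 →
        q ⬝ᵥ (Fin.init (F' (q, q ⬝ᵥ (Fin.init x : Fin L → ℝ))) : Fin L → ℝ) < 0 := by
  have hx := h.1
  -- Both spaces have dimension `L + 1`, so the injective derivative is invertible. The local
  -- inverse takes values that satisfy the first order condition, and uniqueness identifies it with
  -- demand.
  let e : (Fin (L + 1) → ℝ) ≃L[ℝ] (Fin L → ℝ) × ℝ :=
    (LinearEquiv.ofInjectiveOfFinrankEq (fderiv ℝ (supportingPriceIncome u) x).toLinearMap
      (hu.injective_fderiv_supporting hx) (by simp)).toContinuousLinearEquiv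
  have he : (e : (Fin (L + 1) → ℝ) →L[ℝ] (Fin L → ℝ) × ℝ)
      = fderiv ℝ (supportingPriceIncome u) x := by
    ext1 d; rfl
  have hstrict : HasStrictFDerivAt (supportingPriceIncome u)
      (e : (Fin (L + 1) → ℝ) →L[ℝ] (Fin L → ℝ) × ℝ) x := by
    rw [he]
    exact (hu.contDiffAt_supportingPriceIncome hx).hasStrictFDerivAt (by simp)
  have hsx := h.supporting_eq hu hp
  have hinv := hstrict.to_localInverse
  have hright := hstrict.eventually_right_inverse
  have hcont := hstrict.localInverse_continuousAt
  have hself := hstrict.localInverse_apply_image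
  rw [hsx] at hinv hright hcont hself
  have hmem := hcont.eventually ((isOpen_commoditySpace L).mem_nhds (by rwa [hself]))
  have hdem : ∀ᶠ z : (Fin L → ℝ) × ℝ in 𝓝 (Fin.init p, w),
      IsDemand u (Fin.snoc z.1 1) z.2
        (hstrict.localInverse (supportingPriceIncome u) e x z) ∧
      (Fin.snoc z.1 1 : Fin (L + 1) → ℝ) ∈ priceSet L := by
    filter_upwards [hright, hmem] with z hz hzm
    have h1 := hu.isDemand_supporting hzm
    have h2 := hu.supporting_fst_pos hzm
    rw [hz] at h1 h2
    exact ⟨h1, snoc_mem_priceSet h2⟩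
  have hF : ∀ z, fderiv ℝ (supportingPriceIncome u) x (e.symm z) = z := fun z => by
    rw [← he]; exact e.apply_symm_apply z
  refine ⟨e.symm, hinv.congr_of_eventuallyEq ?_, ?_, fun z => ?_, fun q hq => ?_⟩
  · filter_upwards [hdem] with z hz
    exact (hz.1.demand_eq hu hz.2).symm
  · filter_upwards [hdem] with z hz
    exact isDemand_demand ⟨_, hz.1⟩
  · have := hu.fderiv_eq_fderiv_supporting hx (e.symm z)
    rwa [hF] at this
  · have hne : e.symm (q, q ⬝ᵥ (Fin.init x : Fin L → ℝ)) ≠ 0 := fun h0 => by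
      simp only [map_eq_zero_iff _ e.symm.injective, Prod.mk_eq_zero] at h0
      exact hq h0.1
    have := hu.fderiv_supporting_dotProduct_neg hx hne (by rw [hF])
    rwa [hF] at this

end Supporting

/-! ### Signs of determinants. -/

section Determinants

open Matrix

/-- A real matrix with positive definite (not necessarily symmetric) bilinear form has positive
determinant. -/
theorem det_pos_of_dotProduct_mulVec_pos {n : Type*} [Fintype n] [DecidableEq n]
    {A : Matrix n n ℝ} (h : ∀ v, v ≠ 0 → 0 < v ⬝ᵥ A *ᵥ v) : 0 < A.det := by
  -- The segment from the identity to `A` consists of positive definite forms, so the determinant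
  -- never vanishes along it and keeps its sign.
  have hne : ∀ t ∈ Set.Icc (0 : ℝ) 1, ((1 - t) • (1 : Matrix n n ℝ) + t • A).det ≠ 0 := by
    intro t ht h0
    obtain ⟨v, hv, hv0⟩ := Matrix.exists_mulVec_eq_zero_iff.2 h0
    have h1 : v ⬝ᵥ ((1 - t) • (1 : Matrix n n ℝ) + t • A) *ᵥ v = 0 := by simp [hv0]
    rw [add_mulVec, smul_mulVec, smul_mulVec, one_mulVec, dotProduct_add, dotProduct_smul,
      dotProduct_smul, smul_eq_mul, smul_eq_mul] at h1
    have h2 := h v hv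
    have h3 : 0 < v ⬝ᵥ v := by
      simpa using Matrix.dotProduct_star_self_pos_iff.2 hv
    rcases ht.1.eq_or_lt with rfl | ht0
    · simp at h1; exact hv h1
    · have := mul_nonneg (sub_nonneg.2 ht.2) h3.le
      have := mul_pos ht0 h2
      linarith
  have hc : ContinuousOn (fun t : ℝ => ((1 - t) • (1 : Matrix n n ℝ) + t • A).det)
      (Set.Icc 0 1) := by
    refine Continuous.continuousOn (Continuous.matrix_det ?_)
    fun_prop
  by_contra! hle
  obtain ⟨t, ht, ht0⟩ := intermediate_value_Icc' zero_le_one hc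
    (show (0 : ℝ) ∈ Set.Icc _ _ by simpa using hle)
  exact hne t ht ht0

/-- Two block triangular factorizations carry this: one relates the frame to the price block of `T
(a k)`, the other shows that `det T` has sign `(-1)^L`. In the application `c` holds marginal
utilities and `X` the demands for the non-numeraire goods. -/
theorem sign_neg_one_pow_mul_det_eq_sign_frameDet {L N : ℕ}
    (T : (Fin L ⊕ Fin N → ℝ) →ₗ[ℝ] (Fin L ⊕ Fin N → ℝ)) (c : Fin N → ℝ)
    (X : Fin N → Fin L → ℝ) (hc : ∀ i, 0 < c i)
    (hT : ∀ b i, T b (Sum.inr i) = c i * (b (Sum.inr i) - (fun j => b (Sum.inl j)) ⬝ᵥ X i))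
    (hneg : ∀ q, q ≠ 0 → q ⬝ᵥ (fun j => T (Sum.elim q fun i => q ⬝ᵥ X i) (Sum.inl j)) < 0)
    (a : Fin L → Fin L ⊕ Fin N → ℝ) (b : Fin N → Fin L ⊕ Fin N → ℝ)
    (hb : ∀ i, T (b i) = Sum.elim (0 : Fin L → ℝ) (Pi.single i 1)) :
    SignType.sign ((-1 : ℝ) ^ L * (Matrix.of fun j k => T (a k) (Sum.inl j)).det)
      = SignType.sign (frameDet a b) := by
  set A := LinearMap.toMatrix' T with hA
  have hmul : ∀ (B : Matrix (Fin L ⊕ Fin N) (Fin L ⊕ Fin N) ℝ) i k,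
      (A * B) i k = T (fun r => B r k) i := by
    intro B i k
    rw [← LinearMap.toMatrix'_mulVec T]
    rfl
  have h1 : A * (Matrix.of fun row col => Sum.elim a b col row) =
      fromBlocks (Matrix.of fun j k => T (a k) (Sum.inl j)) 0
        (Matrix.of fun j k => T (a k) (Sum.inr j)) 1 := by
    ext (i | i) (k | k) <;> rw [hmul]
    · simp
    · simp [hb]
    · simp
    · simp [hb, Matrix.one_apply, Pi.single_apply]
  set S : Matrix (Fin L) (Fin L) ℝ := Matrix.of fun j k =>
    T (Sum.elim (Pi.single k 1) fun i => X i k) (Sum.inl j) with hS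
  -- The unipotent factor replaces unit price changes by compensated ones; `hT` then makes the lower
  -- left block vanish.
  have h2 : A * fromBlocks 1 0 (Matrix.of X) 1 =
      fromBlocks S (Matrix.of fun j k => T (Sum.elim (0 : Fin L → ℝ) (Pi.single k 1)) (Sum.inl j)) 0
        (Matrix.diagonal c) := by
    have e1 : ∀ k : Fin L, (fun r => fromBlocks (1 : Matrix (Fin L) (Fin L) ℝ) 0 (Matrix.of X)
        (1 : Matrix (Fin N) (Fin N) ℝ) r (Sum.inl k)) = Sum.elim (Pi.single k 1) fun i => X i k := by
      intro k; ext (i | i) <;> simp [Matrix.one_apply, Pi.single_apply]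
    have e2 : ∀ k : Fin N, (fun r => fromBlocks (1 : Matrix (Fin L) (Fin L) ℝ) 0 (Matrix.of X)
        (1 : Matrix (Fin N) (Fin N) ℝ) r
        (Sum.inr k)) = Sum.elim (0 : Fin L → ℝ) (Pi.single k 1) := by
      intro k; ext (i | i) <;> simp [Matrix.one_apply, Pi.single_apply]
    ext (i | i) (k | k) <;> rw [hmul]
    · rw [e1]; simp [hS]
    · rw [e2]; simp
    · rw [e1, hT]; simp
    · rw [e2, hT]
      simp [Matrix.diagonal_apply, Pi.single_apply, dotProduct]
  have hdS : 0 < (-1 : ℝ) ^ L * S.det := by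
    have : 0 < (-S).det := by
      refine det_pos_of_dotProduct_mulVec_pos fun q hq => ?_
      have h := hneg q hq
      have hq' : (Sum.elim q fun i => q ⬝ᵥ X i : Fin L ⊕ Fin N → ℝ) =
          ∑ k, q k • (Sum.elim (Pi.single k 1) fun i => X i k) := by
        ext (i | i) <;> simp [Finset.sum_apply, dotProduct, Pi.single_apply]
      have hSq : S *ᵥ q = fun j => T (Sum.elim q fun i => q ⬝ᵥ X i) (Sum.inl j) := by
        rw [hq']
        ext j
        simp [mulVec, dotProduct, hS, mul_comm]
      rw [neg_mulVec, dotProduct_neg, hSq]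
      linarith
    simpa [det_neg] using this
  have d1 : A.det * frameDet a b = (Matrix.of fun j k => T (a k) (Sum.inl j)).det := by
    have := congrArg Matrix.det h1
    rwa [det_mul, det_fromBlocks_zero₁₂, det_one, mul_one] at this
  have d2 : A.det = S.det * ∏ i, c i := by
    have := congrArg Matrix.det h2
    rwa [det_mul, det_fromBlocks_zero₁₂, det_one, det_one, mul_one, mul_one,
      det_fromBlocks_zero₂₁, det_diagonal] at this
  have hpos : 0 < (-1 : ℝ) ^ L * A.det := by
    rw [d2, ← mul_assoc]
    exact mul_pos hdS (Finset.prod_pos fun i _ => hc i)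
  rw [← d1, ← mul_assoc, sign_mul, sign_pos hpos, one_mul]

end Determinants

variable {L N : ℕ} {u : Fin (N + 1) → (Fin (L + 1) → ℝ) → ℝ} {r p : Fin (L + 1) → ℝ}

/-! ### Demands that clear the markets as Pareto solutions. -/

section Pareto

theorem sum_eq_last_of_sum_eq {M : Type*} [AddCommGroup M] {f g : Fin (N + 1) → M}
    (h : ∑ i, f i = ∑ i, g i) (hi : ∀ i : Fin N, f i.castSucc = g i.castSucc) : f = g := by
  rw [Fin.sum_univ_castSucc, Fin.sum_univ_castSucc, Finset.sum_congr rfl fun i _ => hi i,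
    add_right_inj] at h
  exact funext fun i => Fin.lastCases h hi i

theorem sum_dotProduct_eq {x : Fin (N + 1) → Fin (L + 1) → ℝ} (hx : ∑ i, x i = r)
    (p : Fin (L + 1) → ℝ) : ∑ i, p ⬝ᵥ x i = p ⬝ᵥ r := by
  rw [← hx, dotProduct_sum]

/-- An allocation of the total resources that consists of demands is the only Pareto solution for
its utility levels. -/
theorem eq_of_isParetoSolution (hu : ∀ i, IsSmoothUtility (u i)) (hp : p ∈ priceSet L)
    {w : Fin (N + 1) → ℝ} {v : Fin N → ℝ} {x y : Fin (N + 1) → Fin (L + 1) → ℝ}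
    (hx : ∀ i, IsDemand (u i) p (w i) (x i)) (hsum : ∑ i, x i = r)
    (hv : ∀ i : Fin N, u i.castSucc (x i.castSucc) = v i) (hy : IsFeasible u r v y)
    (hle : u (Fin.last N) (x (Fin.last N)) ≤ u (Fin.last N) (y (Fin.last N))) : y = x := by
  -- No trader is worse off in `y`, so each bundle costs at least the income. Both allocations have
  -- total value `p ⬝ᵥ r`, so all these inequalities are equalities, and strict optimality forces `y
  -- = x`.
  have hge : ∀ i, w i ≤ p ⬝ᵥ y i := fun i => (hx i).le_of_le (hu i) hp (hy.1 i) (by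
    refine Fin.lastCases hle (fun i => ?_) i
    rw [hv, hy.2.1])
  have hsumw : ∑ i, w i = ∑ i, p ⬝ᵥ y i := by
    rw [sum_dotProduct_eq hy.2.2, ← sum_dotProduct_eq hsum]
    exact Finset.sum_congr rfl fun i _ => ((hx i).dotProduct_eq (hu i)).symm
  have heq := (Finset.sum_eq_sum_iff_of_le fun i _ => hge i).1 hsumw
  funext i
  by_contra hne
  have hlt := (hx i).lt_of_ne (hu i) hp (hy.1 i) (heq i (Finset.mem_univ i)).ge hne
  revert hlt
  refine Fin.lastCases (fun h => absurd hle (not_le.2 h)) (fun i h => ?_) i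
  rw [hv, hy.2.1] at h
  exact lt_irrefl _ h

theorem isParetoSolution_of_isDemand (hu : ∀ i, IsSmoothUtility (u i)) (hp : p ∈ priceSet L)
    {w : Fin (N + 1) → ℝ} {v : Fin N → ℝ} {x : Fin (N + 1) → Fin (L + 1) → ℝ}
    (hx : ∀ i, IsDemand (u i) p (w i) (x i)) (hsum : ∑ i, x i = r)
    (hv : ∀ i : Fin N, u i.castSucc (x i.castSucc) = v i) : IsParetoSolution u r v x := by
  refine ⟨⟨fun i => (hx i).1, hv, hsum⟩, fun y hy => ?_⟩
  by_contra! hlt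
  exact hlt.ne (by rw [eq_of_isParetoSolution hu hp hx hsum hv hy hlt.le])

/-- The choices in the definition of `paretoMap` are harmless: the Pareto solution is unique, and
one trader's bundle already determines the supporting prices. -/
theorem paretoMap_eq_of_isDemand (hu : ∀ i, IsSmoothUtility (u i)) (hp : p ∈ priceSet L)
    {w : Fin (N + 1) → ℝ} {v : Fin N → ℝ} {x : Fin (N + 1) → Fin (L + 1) → ℝ}
    (hx : ∀ i, IsDemand (u i) p (w i) (x i)) (hsum : ∑ i, x i = r)
    (hv : ∀ i : Fin N, u i.castSucc (x i.castSucc) = v i) : paretoMap u r v = (p, w) := by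
  have hsol := isParetoSolution_of_isDemand hu hp hx hsum hv
  have halloc : paretoAllocation u r v = x := by
    have h : IsParetoSolution u r v (paretoAllocation u r v) := Classical.epsilon_spec ⟨x, hsol⟩
    exact eq_of_isParetoSolution hu hp hx hsum hv h.1 (h.2 x hsol.1)
  have hsupp : Supports u p x := ⟨hp, fun i => by
    rw [(hx i).dotProduct_eq (hu i)]; exact hx i⟩
  have hprice : paretoPrice u r v = p := by
    have h : Supports u (paretoPrice u r v) (paretoAllocation u r v) :=
      Classical.epsilon_spec (p := fun q => Supports u q (paretoAllocation u r v))
        ⟨p, by rwa [halloc]⟩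
    rw [halloc] at h
    exact (hx 0).price_unique (hu 0) hp h.1 (h.2 0)
  refine Prod.ext hprice (funext fun i => ?_)
  simp only [paretoMap]
  rw [hprice, halloc, (hx i).dotProduct_eq (hu i)]

end Pareto

/-! ### Coordinates on the price-income space. -/

section Coordinates

/-- The prices with given coordinates in `H(r)`. -/
def priceOfCoord (c : Fin L ⊕ Fin N → ℝ) : Fin (L + 1) → ℝ :=
  Fin.snoc (fun j => c (Sum.inl j)) 1

/-- The incomes with given coordinates in `H(r)`. -/
noncomputable def incomeOfCoord (r : Fin (L + 1) → ℝ) (c : Fin L ⊕ Fin N → ℝ) :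
    Fin (N + 1) → ℝ :=
  Fin.snoc (fun i => c (Sum.inr i)) (priceOfCoord c ⬝ᵥ r - ∑ i, c (Sum.inr i))

theorem sum_incomeOfCoord (c : Fin L ⊕ Fin N → ℝ) :
    ∑ i, incomeOfCoord r c i = priceOfCoord c ⬝ᵥ r := by
  simp [incomeOfCoord, Fin.sum_univ_castSucc]

theorem coord_ofCoord (c : Fin L ⊕ Fin N → ℝ) :
    coord (priceOfCoord c, incomeOfCoord r c) = c := by
  ext (i | i) <;> simp [coord, priceOfCoord, incomeOfCoord]

theorem priceOfCoord_coord {p : Fin (L + 1) → ℝ} (hp : p (Fin.last L) = 1) (w : Fin (N + 1) → ℝ) :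
    priceOfCoord (coord (p, w)) = p :=
  snoc_init_of_last_eq_one hp

theorem incomeOfCoord_coord {p : Fin (L + 1) → ℝ} (hp : p (Fin.last L) = 1)
    {w : Fin (N + 1) → ℝ} (h : ∑ i, w i = p ⬝ᵥ r) : incomeOfCoord r (coord (p, w)) = w := by
  refine sum_eq_last_of_sum_eq ?_ fun i => ?_
  · rw [sum_incomeOfCoord, priceOfCoord_coord hp, h]
  · simp [incomeOfCoord, coord, Fin.init]

/-- The derivative of the income of trader `i` in the coordinates of `H(r)`. -/
noncomputable def incomeDeriv (r : Fin (L + 1) → ℝ) (i : Fin (N + 1)) :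
    (Fin L ⊕ Fin N → ℝ) →L[ℝ] ℝ :=
  Fin.lastCases (∑ j : Fin L, r j.castSucc • ContinuousLinearMap.proj (Sum.inl j) -
    ∑ i : Fin N, ContinuousLinearMap.proj (Sum.inr i))
    (fun i => ContinuousLinearMap.proj (Sum.inr i)) i

@[simp]
theorem incomeDeriv_castSucc (i : Fin N) (b : Fin L ⊕ Fin N → ℝ) :
    incomeDeriv r i.castSucc b = b (Sum.inr i) := by
  simp [incomeDeriv]

@[simp]
theorem incomeDeriv_last (b : Fin L ⊕ Fin N → ℝ) :
    incomeDeriv r (Fin.last N) b =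
      (fun j => b (Sum.inl j)) ⬝ᵥ (Fin.init r : Fin L → ℝ) - ∑ i, b (Sum.inr i) := by
  simp [incomeDeriv, dotProduct, Fin.init, mul_comm]

theorem hasStrictFDerivAt_incomeOfCoord (i : Fin (N + 1)) (c : Fin L ⊕ Fin N → ℝ) :
    HasStrictFDerivAt (fun c => incomeOfCoord r c i) (incomeDeriv r i) c := by
  have h : (fun c : Fin L ⊕ Fin N → ℝ => incomeOfCoord r c i) =
      fun c => incomeDeriv r i c + incomeOfCoord r 0 i := by
    funext c
    refine Fin.lastCases ?_ (fun i => ?_) i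
    · simp only [incomeOfCoord, Fin.snoc_last, priceOfCoord, snoc_dotProduct, incomeDeriv_last,
        Pi.zero_apply]
      simp [dotProduct]
      ring
    · simp [incomeOfCoord]
  rw [h]
  exact (incomeDeriv r i).hasStrictFDerivAt.add_const _

/-- The restriction to the price coordinates. -/
def priceProj (L N : ℕ) : (Fin L ⊕ Fin N → ℝ) →L[ℝ] (Fin L → ℝ) :=
  ContinuousLinearMap.pi fun j => ContinuousLinearMap.proj (Sum.inl j)

end Coordinates

/-! ### The equilibrium map and its derivative. -/

section EquilibriumMap

/-- The first `L` components of the aggregate excess demand, followed by the utility levels of the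
first `N` traders, in the coordinates of `H(r)`. -/
noncomputable def equilibriumMap (u : Fin (N + 1) → (Fin (L + 1) → ℝ) → ℝ)
    (r : Fin (L + 1) → ℝ) (c : Fin L ⊕ Fin N → ℝ) : Fin L ⊕ Fin N → ℝ :=
  Sum.elim
    (fun j => ∑ i, demand (u i) (priceOfCoord c) (incomeOfCoord r c i) j.castSucc
      - r j.castSucc)
    (fun i => u i.castSucc (demand (u i.castSucc) (priceOfCoord c) (c (Sum.inr i))))

theorem equilibriumMap_inl (c : Fin L ⊕ Fin N → ℝ) (j : Fin L) :
    equilibriumMap u r c (Sum.inl j) =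
      (∑ i, demand (u i) (priceOfCoord c) (incomeOfCoord r c i) - r) j.castSucc := by
  simp [equilibriumMap]

/-- Walras' law: if the first `L` markets clear, so does the last one. -/
theorem sum_demand_eq_of_equilibriumMap_inl (hu : ∀ i, IsSmoothUtility (u i))
    {c : Fin L ⊕ Fin N → ℝ}
    (hd : ∀ i, IsDemand (u i) (priceOfCoord c) (incomeOfCoord r c i)
      (demand (u i) (priceOfCoord c) (incomeOfCoord r c i)))
    (h : ∀ j, equilibriumMap u r c (Sum.inl j) = 0) :
    ∑ i, demand (u i) (priceOfCoord c) (incomeOfCoord r c i) = r := by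
  have h1 : priceOfCoord c ⬝ᵥ
      (∑ i, demand (u i) (priceOfCoord c) (incomeOfCoord r c i) - r) = 0 := by
    rw [dotProduct_sub, dotProduct_sum, ← sum_incomeOfCoord, sub_eq_zero]
    exact Finset.sum_congr rfl fun i _ => (hd i).dotProduct_eq (hu i)
  set z := ∑ i, demand (u i) (priceOfCoord c) (incomeOfCoord r c i) - r with hz
  have h2 : (Fin.init z : Fin L → ℝ) = 0 := funext fun j => by
    rw [Pi.zero_apply, ← h j, equilibriumMap_inl]; rfl
  have h3 : z (Fin.last L) = 0 := by
    rw [priceOfCoord, snoc_dotProduct, h2] at h1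
    simpa using h1
  have h4 : z = 0 := funext fun j => Fin.lastCases h3 (fun j => congrFun h2 j) j
  exact sub_eq_zero.1 h4

/-- The utility rows of the derivative are Roy's identity; the price rows, along compensated price
changes, sum the substitution effects of all traders. Together they give invertibility. -/
theorem exists_hasStrictFDerivAt_equilibriumMap (hu : ∀ i, IsSmoothUtility (u i))
    {c : Fin L ⊕ Fin N → ℝ} (hp : priceOfCoord c ∈ priceSet L)
    {x : Fin (N + 1) → Fin (L + 1) → ℝ}
    (hx : ∀ i, IsDemand (u i) (priceOfCoord c) (incomeOfCoord r c i) (x i))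
    (hsum : ∑ i, x i = r) :
    ∃ T : (Fin L ⊕ Fin N → ℝ) ≃L[ℝ] (Fin L ⊕ Fin N → ℝ),
      HasStrictFDerivAt (equilibriumMap u r)
        (T : (Fin L ⊕ Fin N → ℝ) →L[ℝ] (Fin L ⊕ Fin N → ℝ)) c ∧
      (∀ᶠ b in 𝓝 c, ∀ i, IsDemand (u i) (priceOfCoord b) (incomeOfCoord r b i)
        (demand (u i) (priceOfCoord b) (incomeOfCoord r b i))) ∧
      (∀ b i, T b (Sum.inr i) = marginalUtility (u i.castSucc) (x i.castSucc) *
        (b (Sum.inr i) - (fun j => b (Sum.inl j)) ⬝ᵥ (Fin.init (x i.castSucc) : Fin L → ℝ))) ∧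
      ∀ q, q ≠ 0 → q ⬝ᵥ (fun j => T (Sum.elim q fun i : Fin N =>
        q ⬝ᵥ (Fin.init (x i.castSucc) : Fin L → ℝ)) (Sum.inl j)) < 0 := by
  choose F hF hFev hFroy hFneg using fun i => (hx i).exists_hasStrictFDerivAt (hu i) hp
  have hinit : (Fin.init (priceOfCoord c) : Fin L → ℝ) = priceProj L N c := Fin.init_snoc _ _
  simp only [hinit] at hF hFev
  have hinc : ∀ i, HasStrictFDerivAt (fun b => (priceProj L N b, incomeOfCoord r b i))
      ((priceProj L N).prod (incomeDeriv r i)) c := fun i =>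
    (priceProj L N).hasStrictFDerivAt.prodMk (hasStrictFDerivAt_incomeOfCoord i c)
  let D : Fin (N + 1) → (Fin L ⊕ Fin N → ℝ) →L[ℝ] (Fin (L + 1) → ℝ) := fun i =>
    (F i).comp ((priceProj L N).prod (incomeDeriv r i))
  have hD : ∀ i, HasStrictFDerivAt
      (fun b => demand (u i) (priceOfCoord b) (incomeOfCoord r b i)) (D i) c := fun i =>
    HasStrictFDerivAt.comp c (g := fun z : (Fin L → ℝ) × ℝ => demand (u i) (Fin.snoc z.1 1) z.2)
      (hF i) (hinc i)
  let T : (Fin L ⊕ Fin N → ℝ) →L[ℝ] (Fin L ⊕ Fin N → ℝ) := ContinuousLinearMap.pi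
    (Sum.elim (fun j => ∑ i, (ContinuousLinearMap.proj j.castSucc).comp (D i))
      (fun i => (fderiv ℝ (u i.castSucc) (x i.castSucc)).comp (D i.castSucc)))
  have hT : HasStrictFDerivAt (equilibriumMap u r) T c := by
    refine hasStrictFDerivAt_pi'.2 ?_
    rintro (j | i)
    · exact (HasStrictFDerivAt.fun_sum fun i _ =>
        hasStrictFDerivAt_pi'.1 (hD i) j.castSucc).sub_const _
    · have h1 := hD i.castSucc
      have h2 : HasStrictFDerivAt (u i.castSucc) (fderiv ℝ (u i.castSucc) (x i.castSucc))
          (demand (u i.castSucc) (priceOfCoord c) (incomeOfCoord r c i.castSucc)) := by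
        rw [(hx _).demand_eq (hu _) hp]
        exact ((hu _).contDiffAt (hx _).1).hasStrictFDerivAt (by simp)
      have h3 := h2.comp c h1
      simp only [incomeOfCoord, Fin.snoc_castSucc] at h3
      exact h3
  have hroy : ∀ b i, T b (Sum.inr i) = marginalUtility (u i.castSucc) (x i.castSucc) *
      (b (Sum.inr i) - (fun j => b (Sum.inl j)) ⬝ᵥ (Fin.init (x i.castSucc) : Fin L → ℝ)) := by
    intro b i
    have h : T b (Sum.inr i) = fderiv ℝ (u i.castSucc) (x i.castSucc)
        (F i.castSucc (priceProj L N b, incomeDeriv r i.castSucc b)) := rfl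
    rw [h, hFroy, incomeDeriv_castSucc]
    rfl
  have hneg : ∀ q, q ≠ 0 → q ⬝ᵥ (fun j => T (Sum.elim q fun i : Fin N =>
      q ⬝ᵥ (Fin.init (x i.castSucc) : Fin L → ℝ)) (Sum.inl j)) < 0 := by
    intro q hq
    set b : Fin L ⊕ Fin N → ℝ := Sum.elim q fun i : Fin N =>
      q ⬝ᵥ (Fin.init (x i.castSucc) : Fin L → ℝ) with hb
    have hbq : priceProj L N b = q := rfl
    -- Compensating the first `N` traders compensates the last one too, because incomes sum to the
    -- value of `r` and the demands sum to `r`.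
    have hbi : ∀ i, incomeDeriv r i b = q ⬝ᵥ (Fin.init (x i) : Fin L → ℝ) := by
      refine fun i => congrFun (sum_eq_last_of_sum_eq (f := fun i => incomeDeriv r i b)
        (g := fun i => q ⬝ᵥ (Fin.init (x i) : Fin L → ℝ)) ?_ fun i => ?_) i
      · rw [Fin.sum_univ_castSucc, incomeDeriv_last]
        simp only [incomeDeriv_castSucc]
        rw [add_sub_cancel, ← dotProduct_sum]
        congr 1
        funext j
        simp [Fin.init, ← hsum]
      · simp [hb]
    have hsumT : (fun j => T b (Sum.inl j)) = ∑ i, (Fin.init (D i b) : Fin L → ℝ) := by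
      funext j
      simp [T, Fin.init]
    rw [hsumT, dotProduct_sum]
    refine Finset.sum_neg (fun i _ => ?_) Finset.univ_nonempty
    have := hFneg i q hq
    rwa [← hbi] at this
  have hinj : Function.Injective T := by
    refine (injective_iff_map_eq_zero T).2 fun b hb => ?_
    -- Vanishing utility rows make a kernel vector a compensated price change; negativity then kills
    -- its price part.
    have hbi : b = Sum.elim (fun j => b (Sum.inl j)) fun i : Fin N =>
        (fun j => b (Sum.inl j)) ⬝ᵥ (Fin.init (x i.castSucc) : Fin L → ℝ) := by
      ext (j | i)
      · rfl
      · have h := hroy b i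
        rw [hb] at h
        have hm := (hu i.castSucc).marginalUtility_pos (hx i.castSucc).1
        simpa [hm.ne', sub_eq_zero] using h
    have hq : (fun j => b (Sum.inl j)) = 0 := by
      by_contra hne
      have h := hneg _ hne
      rw [← hbi, hb] at h
      simp [dotProduct] at h
    rw [hbi, hq]
    ext (j | i) <;> simp
  refine ⟨(LinearEquiv.ofInjectiveEndo T.toLinearMap hinj).toContinuousLinearEquiv, ?_, ?_,
    hroy, hneg⟩
  · convert hT using 1
    ext1 b
    rfl
  · refine eventually_all.2 fun i => ?_
    exact (hinc i).continuousAt.eventually (hFev i)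

end EquilibriumMap

end ExchangeEconomy

namespace ExchangeEconomy

/-! ### Tangent cones of parametrized sets and of zero sets. -/

section TangentSpaces

variable {κ : Type*} [Fintype κ]

theorem mem_tangentConeAt_of_hasFDerivAt {E : Type*} [NormedAddCommGroup E] [NormedSpace ℝ E]
    {A : Set (κ → ℝ)} {f : E → κ → ℝ} {f' : E →L[ℝ] κ → ℝ} {y : E} (hf : HasFDerivAt f f' y)
    (h : ∀ᶠ v in 𝓝 y, f v ∈ A) (v : E) : f' v ∈ tangentConeAt ℝ A (f y) := by
  have h1 := (hf.hasFDerivWithinAt (s := {v | f v ∈ A})).mapsTo_tangent_cone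
  rw [tangentConeAt_of_mem_nhds h] at h1
  exact tangentConeAt_mono (Set.image_subset_iff.2 fun _ hv => hv) (h1 (Set.mem_univ v))

/-- The derivative maps tangent vectors of `A` to tangent vectors of `f '' A`, which lies in `{0}`
and so has no accumulation point. This bounds tangent spaces from above; parametrizations bound them
from below. -/
theorem map_eq_zero_of_mem_tangentConeAt {E : Type*} [NormedAddCommGroup E] [NormedSpace ℝ E]
    {A : Set (κ → ℝ)} {f : (κ → ℝ) → E} {f' : (κ → ℝ) →L[ℝ] E} {x : κ → ℝ}
    (hf : HasFDerivAt f f' x) (hA : ∀ y ∈ A, f y = 0) {b : κ → ℝ}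
    (hb : b ∈ tangentConeAt ℝ A x) : f' b = 0 := by
  have h1 := (hf.hasFDerivWithinAt (s := A)).mapsTo_tangent_cone hb
  have h2 : f '' A ⊆ {0} := Set.image_subset_iff.2 hA
  refine tangentConeAt_subset_zero (fun hacc => ?_) h1
  have h3 := accPt_iff_nhds.1 (hacc.mono (principal_mono.2 h2))
  obtain ⟨y, ⟨-, rfl⟩, hy⟩ := h3 Set.univ univ_mem
  obtain ⟨z, ⟨hz, hz'⟩, -⟩ := h3 {0}ᶜ (isOpen_compl_singleton.mem_nhds hy.symm)
  exact hz hz'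

theorem span_range_eq_tangentSpaceAt {n : Type*} {A : Set (κ → ℝ)} {x : κ → ℝ}
    {a : n → κ → ℝ} (h : ∀ k, a k ∈ tangentConeAt ℝ A x)
    (h' : ∀ b ∈ tangentConeAt ℝ A x, b ∈ Submodule.span ℝ (Set.range a)) :
    Submodule.span ℝ (Set.range a) = tangentSpaceAt A x :=
  le_antisymm (Submodule.span_mono (Set.range_subset_iff.2 h)) (Submodule.span_le.2 h')

end TangentSpaces

/-! ### Frames with nonzero determinant. -/

section Frames

variable {L N : ℕ} {a : Fin L → Fin L ⊕ Fin N → ℝ} {b : Fin N → Fin L ⊕ Fin N → ℝ}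

theorem linearIndependent_of_frameDet_ne_zero (h : frameDet a b ≠ 0) :
    LinearIndependent ℝ (Sum.elim a b) :=
  Matrix.linearIndependent_cols_of_det_ne_zero h

theorem isCompl_span_of_frameDet_ne_zero (h : frameDet a b ≠ 0) :
    IsCompl (Submodule.span ℝ (Set.range a)) (Submodule.span ℝ (Set.range b)) := by
  have hli := linearIndependent_of_frameDet_ne_zero h
  refine ⟨(linearIndependent_sum.1 hli).2.2, ?_⟩
  rw [codisjoint_iff, ← Submodule.span_union, ← Set.Sum.elim_range]
  exact hli.span_eq_top_of_card_eq_finrank' (by simp)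

end Frames

variable {L N : ℕ} {u : Fin (N + 1) → (Fin (L + 1) → ℝ) → ℝ} {r p : Fin (L + 1) → ℝ}
  {ω : Fin (N + 1) → Fin (L + 1) → ℝ}

/-! ### The budget space and the Jacobian of excess demand. -/

section Budget

/-- The affine parametrization of the budget space by the prices. -/
def budgetParam (ω : Fin (N + 1) → Fin (L + 1) → ℝ) (q : Fin L → ℝ) : Fin L ⊕ Fin N → ℝ :=
  coord (Fin.snoc q 1, fun i => (Fin.snoc q 1 : Fin (L + 1) → ℝ) ⬝ᵥ ω i)

/-- The derivative of `budgetParam`. -/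
noncomputable def budgetDeriv (ω : Fin (N + 1) → Fin (L + 1) → ℝ) :
    (Fin L → ℝ) →L[ℝ] Fin L ⊕ Fin N → ℝ :=
  ∑ k, (ContinuousLinearMap.proj k : (Fin L → ℝ) →L[ℝ] ℝ).smulRight (budgetVector ω k)

theorem budgetDeriv_apply (q : Fin L → ℝ) :
    budgetDeriv ω q = ∑ k, q k • budgetVector ω k := by
  simp [budgetDeriv]

theorem budgetDeriv_inl (q : Fin L → ℝ) (j : Fin L) : budgetDeriv ω q (Sum.inl j) = q j := by
  simp [budgetDeriv_apply, budgetVector, Pi.single_apply]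

theorem budgetDeriv_inr (q : Fin L → ℝ) (i : Fin N) :
    budgetDeriv ω q (Sum.inr i) = q ⬝ᵥ (Fin.init (ω i.castSucc) : Fin L → ℝ) := by
  simp [budgetDeriv_apply, budgetVector, dotProduct, Fin.init]

theorem budgetParam_eq (q : Fin L → ℝ) :
    budgetParam ω q = budgetDeriv ω q + budgetParam ω 0 := by
  ext (j | i)
  · simp [budgetParam, coord, budgetDeriv_inl]
  · simp [budgetParam, coord, budgetDeriv_inr, Fin.init, snoc_dotProduct]

theorem hasFDerivAt_budgetParam (q : Fin L → ℝ) :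
    HasFDerivAt (budgetParam ω) (budgetDeriv ω) q := by
  rw [funext (budgetParam_eq (ω := ω))]
  exact (budgetDeriv ω).hasFDerivAt.add_const _

theorem budgetDeriv_single (k : Fin L) :
    budgetDeriv ω (Pi.single k 1) = budgetVector ω k := by
  simp [budgetDeriv_apply, Pi.single_apply]

theorem budgetParam_init (hp : p ∈ priceSet L) :
    budgetParam ω (Fin.init p) = coord (p, fun i => p ⬝ᵥ ω i) := by
  simp only [budgetParam, snoc_init_of_last_eq_one hp.2]

theorem dotProduct_pos_of_mem (hp : p ∈ priceSet L) {x : Fin (L + 1) → ℝ}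
    (hx : x ∈ commoditySpace L) : 0 < p ⬝ᵥ x :=
  Finset.sum_pos (fun j _ => mul_pos (hp.1 j) (hx j)) Finset.univ_nonempty

theorem incomes_mem_budgetSpace (hp : p ∈ priceSet L) (hω : ω ∈ endowmentSpace r) :
    (p, fun i => p ⬝ᵥ ω i) ∈ budgetSpace r ω :=
  ⟨⟨hp, fun i => dotProduct_pos_of_mem hp (hω.1 i), sum_dotProduct_eq hω.2 p⟩, fun _ => rfl⟩

/-- The budget space is parametrized affinely by the positive prices, and the difference between a
point and the parametrization at its prices vanishes on it. -/
theorem span_budgetVector_eq (hp : p ∈ priceSet L) (hω : ω ∈ endowmentSpace r) :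
    Submodule.span ℝ (Set.range (budgetVector ω)) =
      tangentSpaceAt (coord '' budgetSpace r ω) (coord (p, fun i => p ⬝ᵥ ω i)) := by
  refine span_range_eq_tangentSpaceAt (fun k => ?_) fun b hb => ?_
  · rw [← budgetDeriv_single, ← budgetParam_init hp]
    refine mem_tangentConeAt_of_hasFDerivAt (hasFDerivAt_budgetParam _) ?_ _
    have : ∀ᶠ q : Fin L → ℝ in 𝓝 (Fin.init p), ∀ j, 0 < q j :=
      eventually_all.2 fun j => (continuous_apply j).continuousAt.eventually_const_lt (hp.1 _)
    filter_upwards [this] with q hq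
    exact ⟨_, incomes_mem_budgetSpace (snoc_mem_priceSet hq) hω, rfl⟩
  · have hf : HasFDerivAt (fun c : Fin L ⊕ Fin N → ℝ => c - budgetParam ω (priceProj L N c))
        (ContinuousLinearMap.id ℝ _ - (budgetDeriv ω).comp (priceProj L N))
        (coord (p, fun i => p ⬝ᵥ ω i)) :=
      (hasFDerivAt_id _).sub
        ((hasFDerivAt_budgetParam _).comp _ (priceProj L N).hasFDerivAt)
    have h := map_eq_zero_of_mem_tangentConeAt hf (A := coord '' budgetSpace r ω) (by
      rintro _ ⟨⟨q, w⟩, ⟨hq, hw⟩, rfl⟩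
      have h1 : priceProj L N (coord (q, w)) = (Fin.init q : Fin L → ℝ) := rfl
      rw [h1, budgetParam_init hq.1, sub_eq_zero]
      ext (j | i)
      · rfl
      · exact hw i) hb
    have h2 : b = budgetDeriv ω (priceProj L N b) := sub_eq_zero.1 h
    rw [h2, budgetDeriv_apply]
    exact Submodule.sum_mem _ fun k _ => Submodule.smul_mem _ _ (Submodule.subset_span ⟨k, rfl⟩)

/-- Since the endowments sum to `r`, the last income recovered from the coordinates is also the
value of an endowment. The Jacobian is thus the price block of the derivative along the budget
space. -/
theorem excessDemand_eq_equilibriumMap (hω : ω ∈ endowmentSpace r) (q : Fin L → ℝ) (j : Fin L) :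
    (Fin.init (excessDemand u r (Fin.snoc q 1) ω) : Fin L → ℝ) j =
      equilibriumMap u r (budgetParam ω q) (Sum.inl j) := by
  have h1 : (Fin.snoc q 1 : Fin (L + 1) → ℝ) (Fin.last L) = 1 := by simp
  rw [equilibriumMap_inl, budgetParam, priceOfCoord_coord h1,
    incomeOfCoord_coord h1 (sum_dotProduct_eq hω.2 _)]
  rfl

theorem jacobian_eq (hp : p ∈ priceSet L) (hω : ω ∈ endowmentSpace r)
    {T : (Fin L ⊕ Fin N → ℝ) →L[ℝ] (Fin L ⊕ Fin N → ℝ)}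
    (hT : HasFDerivAt (equilibriumMap u r) T (coord (p, fun i => p ⬝ᵥ ω i))) :
    jacobian u r p ω = Matrix.of fun j k => T (budgetVector ω k) (Sum.inl j) := by
  rw [← budgetParam_init hp] at hT
  have h : HasFDerivAt (fun q : Fin L → ℝ =>
      (Fin.init (excessDemand u r (Fin.snoc q 1) ω) : Fin L → ℝ))
      ((priceProj L N).comp (T.comp (budgetDeriv ω))) (Fin.init p) := by
    have h1 := (priceProj L N).hasFDerivAt.comp _ (hT.comp _ (hasFDerivAt_budgetParam _))
    refine h1.congr_of_eventuallyEq (Eventually.of_forall fun q => ?_)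
    funext j
    exact excessDemand_eq_equilibriumMap hω q j
  ext j k
  rw [jacobian, Matrix.of_apply, Matrix.of_apply, h.fderiv, ← budgetDeriv_single]
  rfl

end Budget

/-! ### The section manifold and its Pareto parametrization. -/

section SectionManifold

/-- The inclusion of the utility coordinates. -/
def utilityIncl (L N : ℕ) : (Fin N → ℝ) →L[ℝ] (Fin L ⊕ Fin N → ℝ) :=
  ContinuousLinearMap.pi (Sum.elim 0 fun i => ContinuousLinearMap.proj i)

theorem utilityIncl_apply (v : Fin N → ℝ) : utilityIncl L N v = Sum.elim (0 : Fin L → ℝ) v := by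
  ext (j | i) <;> rfl

/-- In coordinates, the Pareto parametrization inverts the equilibrium map locally. -/
theorem hasFDerivAt_coord_paretoMap (hu : ∀ i, IsSmoothUtility (u i))
    {c : Fin L ⊕ Fin N → ℝ} (hp : priceOfCoord c ∈ priceSet L)
    {T : (Fin L ⊕ Fin N → ℝ) ≃L[ℝ] (Fin L ⊕ Fin N → ℝ)}
    (hT : HasStrictFDerivAt (equilibriumMap u r)
      (T : (Fin L ⊕ Fin N → ℝ) →L[ℝ] (Fin L ⊕ Fin N → ℝ)) c)
    (hd : ∀ᶠ b in 𝓝 c, ∀ i, IsDemand (u i) (priceOfCoord b) (incomeOfCoord r b i)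
      (demand (u i) (priceOfCoord b) (incomeOfCoord r b i)))
    {v : Fin N → ℝ} (hv : equilibriumMap u r c = utilityIncl L N v) :
    HasFDerivAt (fun v => coord (paretoMap u r v))
      ((T.symm : (Fin L ⊕ Fin N → ℝ) →L[ℝ] (Fin L ⊕ Fin N → ℝ)).comp (utilityIncl L N)) v ∧
    ∀ᶠ v in 𝓝 v, paretoMap u r v ∈ sectionManifold u r := by
  have hinv := hT.to_localInverse
  have hright := hT.eventually_right_inverse
  have hcont := hT.localInverse_continuousAt
  have hself := hT.localInverse_apply_image
  rw [hv] at hinv hright hcont hself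
  set g := hT.localInverse (equilibriumMap u r) T c with hg
  have hincl : Tendsto (utilityIncl L N) (𝓝 v) (𝓝 (utilityIncl L N v)) :=
    (utilityIncl L N).continuous.continuousAt
  have hgc : Tendsto (fun v => g (utilityIncl L N v)) (𝓝 v) (𝓝 c) := by
    have := hcont.tendsto.comp hincl
    rwa [hself] at this
  have hprice : ∀ᶠ b in 𝓝 c, priceOfCoord b ∈ priceSet L := by
    have : ∀ᶠ b in 𝓝 c, ∀ j : Fin L, 0 < b (Sum.inl j) :=
      eventually_all.2 fun j => (continuous_apply _).continuousAt.eventually_const_lt (by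
        simpa [priceOfCoord] using hp.1 j.castSucc)
    filter_upwards [this] with b hb
    exact snoc_mem_priceSet hb
  have key : ∀ᶠ v in 𝓝 v, paretoMap u r v =
      (priceOfCoord (g (utilityIncl L N v)), incomeOfCoord r (g (utilityIncl L N v))) ∧
      paretoMap u r v ∈ sectionManifold u r := by
    filter_upwards [hgc.eventually hprice, hgc.eventually hd, hincl.eventually hright]
      with v h1 h2 h3
    set b := g (utilityIncl L N v) with hb
    -- The local inverse at `(0, v)` clears the first `L` markets, hence all of them, at utility
    -- levels `v`; its demands are then the Pareto allocation for `v`.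
    have hsum := sum_demand_eq_of_equilibriumMap_inl hu h2 fun j => by rw [h3]; rfl
    have heq : paretoMap u r v = (priceOfCoord b, incomeOfCoord r b) :=
      paretoMap_eq_of_isDemand hu h1 h2 hsum fun i => by
        have := congrFun h3 (Sum.inr i)
        simp only [equilibriumMap, Sum.elim_inr] at this
        simp only [incomeOfCoord, Fin.snoc_castSucc]
        exact this
    refine ⟨heq, ?_⟩
    rw [heq]
    refine ⟨⟨h1, fun i => ?_, sum_incomeOfCoord b⟩, fun i => ⟨_, h2 i⟩, hsum⟩
    change 0 < incomeOfCoord r b i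
    rw [← (h2 i).dotProduct_eq (hu i)]
    exact dotProduct_pos_of_mem h1 (h2 i).1
  refine ⟨?_, key.mono fun _ h => h.2⟩
  refine (hinv.hasFDerivAt.comp v (utilityIncl L N).hasFDerivAt).congr_of_eventuallyEq ?_
  filter_upwards [key] with v hv
  rw [hv.1, coord_ofCoord]
  rfl

/-- The partials are tangent because `paretoMap` stays in the section manifold near `v`. Conversely,
excess demand vanishes on the manifold, so `T` sends a tangent vector into the utility plane, on
which the derivative of the parametrization inverts `T`. -/
theorem span_paretoPartial_eq {c : Fin L ⊕ Fin N → ℝ}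
    {T : (Fin L ⊕ Fin N → ℝ) ≃L[ℝ] (Fin L ⊕ Fin N → ℝ)}
    (hT : HasStrictFDerivAt (equilibriumMap u r)
      (T : (Fin L ⊕ Fin N → ℝ) →L[ℝ] (Fin L ⊕ Fin N → ℝ)) c) {v : Fin N → ℝ}
    (hM : HasFDerivAt (fun v => coord (paretoMap u r v))
      ((T.symm : (Fin L ⊕ Fin N → ℝ) →L[ℝ] (Fin L ⊕ Fin N → ℝ)).comp (utilityIncl L N)) v)
    (hB : ∀ᶠ v in 𝓝 v, paretoMap u r v ∈ sectionManifold u r)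
    (hc : coord (paretoMap u r v) = c) :
    Submodule.span ℝ (Set.range (paretoPartial u r v)) =
      tangentSpaceAt (coord '' sectionManifold u r) c := by
  refine span_range_eq_tangentSpaceAt (fun i => ?_) fun b hb => ?_
  · have := mem_tangentConeAt_of_hasFDerivAt hM (A := coord '' sectionManifold u r)
      (hB.mono fun _ h => ⟨_, h, rfl⟩) (Pi.single i 1)
    rw [hc] at this
    rwa [paretoPartial, hM.fderiv]
  · have h := map_eq_zero_of_mem_tangentConeAt (A := coord '' sectionManifold u r)
      ((priceProj L N).hasFDerivAt.comp c hT.hasFDerivAt) (by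
        rintro _ ⟨⟨q, w⟩, ⟨hq, -, hs⟩, rfl⟩
        funext j
        change equilibriumMap u r (coord (q, w)) (Sum.inl j) = 0
        simp only at hs
        rw [equilibriumMap_inl, priceOfCoord_coord hq.1.2, incomeOfCoord_coord hq.1.2 hq.2.2,
          hs, sub_self]
        rfl) hb
    have h1 : T b = utilityIncl L N (fun i => T b (Sum.inr i)) := by
      ext (j | i)
      · exact congrFun h j
      · rfl
    have h2 : b = fderiv ℝ (fun v => coord (paretoMap u r v)) v (fun i => T b (Sum.inr i)) := by
      rw [hM.fderiv]
      simp [← h1]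
    rw [h2, pi_eq_sum_univ' (fun i => T b (Sum.inr i)), map_sum]
    refine Submodule.sum_mem _ fun i _ => ?_
    rw [map_smul]
    exact Submodule.smul_mem _ _ (Submodule.subset_span ⟨i, rfl⟩)

end SectionManifold

end ExchangeEconomy

/-! ### The index as an intersection number. -/

open ExchangeEconomy in
theorem mainTheorem2 (L N : ℕ) (u : Fin (N + 1) → (Fin (L + 1) → ℝ) → ℝ)
    (hu : ∀ i, ExchangeEconomy.IsSmoothUtility (u i))
    (r p : Fin (L + 1) → ℝ) (ω : Fin (N + 1) → Fin (L + 1) → ℝ)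
    (hreg : ExchangeEconomy.IsRegularEquilibrium u r p ω) :
    (ExchangeEconomy.index u r p ω = 1 ↔ 0 < ExchangeEconomy.delta u r p ω) ∧
    (ExchangeEconomy.index u r p ω = -1 ↔ ExchangeEconomy.delta u r p ω < 0) ∧
    ExchangeEconomy.paretoMap u r (ExchangeEconomy.utilityLevels u p ω) =
      (p, fun i => p ⬝ᵥ ω i) ∧
    ExchangeEconomy.HasIntersectionNumber
      (ExchangeEconomy.coord '' ExchangeEconomy.budgetSpace r ω)
      (ExchangeEconomy.coord '' ExchangeEconomy.sectionManifold u r)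
      (ExchangeEconomy.coord (p, fun i => p ⬝ᵥ ω i))
      (ExchangeEconomy.budgetVector ω)
      (ExchangeEconomy.paretoPartial u r (ExchangeEconomy.utilityLevels u p ω))
      (ExchangeEconomy.index u r p ω) := by
  obtain ⟨⟨hp, hω, hex, hz⟩, hJ⟩ := hreg
  have hx := fun i => isDemand_demand (hex i)
  have hsum : ∑ i, demand (u i) p (p ⬝ᵥ ω i) = r := sub_eq_zero.1 hz
  have hM := paretoMap_eq_of_isDemand (v := utilityLevels u p ω) hu hp hx hsum fun _ => rfl
  set c : Fin L ⊕ Fin N → ℝ := coord (p, fun i => p ⬝ᵥ ω i) with hc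
  have hcp : priceOfCoord c = p := priceOfCoord_coord hp.2 _
  have hcw : incomeOfCoord r c = fun i => p ⬝ᵥ ω i :=
    incomeOfCoord_coord hp.2 (sum_dotProduct_eq hω.2 p)
  have hv : equilibriumMap u r c = utilityIncl L N (utilityLevels u p ω) := by
    ext (j | i)
    · rw [equilibriumMap_inl, hcp, hcw, hsum, sub_self]
      rfl
    · rw [equilibriumMap, Sum.elim_inr, hcp]
      rfl
  obtain ⟨T, hT, hd, hroy, hneg⟩ := exists_hasStrictFDerivAt_equilibriumMap (r := r) hu
    (c := c) (by rwa [hcp]) (by rwa [hcp, hcw]) hsum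
  obtain ⟨hMd, hMB⟩ := hasFDerivAt_coord_paretoMap hu (by rwa [hcp]) hT hd hv
  have hpartial : ∀ i, T (paretoPartial u r (utilityLevels u p ω) i) =
      Sum.elim (0 : Fin L → ℝ) (Pi.single i 1) := fun i => by
    rw [paretoPartial, hMd.fderiv, ← utilityIncl_apply]
    simp
  -- Compensation is measured by the equilibrium demands; the endowments enter only through the
  -- budget vectors of the frame.
  have hsign := sign_neg_one_pow_mul_det_eq_sign_frameDet
    (T : (Fin L ⊕ Fin N → ℝ) ≃ₗ[ℝ] (Fin L ⊕ Fin N → ℝ)).toLinearMap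
    _ _ (fun i => (hu _).marginalUtility_pos (hx i.castSucc).1) hroy hneg
    (budgetVector ω) _ hpartial
  have hjac := jacobian_eq (u := u) hp hω hT.hasFDerivAt
  replace hsign : SignType.sign ((-1 : ℝ) ^ L * (jacobian u r p ω).det) =
      SignType.sign (delta u r p ω) := by
    rw [hjac]; exact hsign
  have hindex : index u r p ω = (SignType.sign (delta u r p ω) : ℤ) := by
    rw [index, hsign]
  have hdet : delta u r p ω ≠ 0 := by
    rw [← sign_ne_zero, ← hsign, sign_ne_zero]
    exact mul_ne_zero (pow_ne_zero _ (by norm_num))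
      ((Matrix.isUnit_iff_isUnit_det _).1 hJ).ne_zero
  have hA := span_budgetVector_eq hp hω
  have hB := span_paretoPartial_eq hT hMd hMB (by rw [hM])
  have hli := linearIndependent_sum.1 (linearIndependent_of_frameDet_ne_zero hdet)
  refine ⟨?_, ?_, hM, ⟨_, incomes_mem_budgetSpace hp hω, rfl⟩, ?_, hli.1, hA, hli.2.1, hB, ?_,
    hindex⟩
  · rw [hindex]
    rcases hdet.lt_or_gt with h | h
    · simp [sign_neg h, h.le]
    · simp [sign_pos h, h]
  · rw [hindex]
    rcases hdet.lt_or_gt with h | h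
    · simp [sign_neg h, h]
    · simp [sign_pos h, h.le]
  · refine ⟨_, hMB.self_of_nhds, ?_⟩
    rw [hM]
  · rw [← hA, ← hB]
    exact isCompl_span_of_frameDet_ne_zero hdet
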